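/- **Setting.** Let $\mathbb N=\{1,2,\dots\}$, let $\mathcal U$ be the set of finite subsets of $\mathbb N$, let $D\subseteq\mathbb R$ with a probability measure $\rho$, and $\mu=\bigotimes_{n\in\mathbb N}\rho$ on $D^{\mathbb N}$. Let $k$ be a measurable reproducing kernel on $D\times D$ with $M:=\int_D k(x,x)\,\rho(dx)<\infty$, $\int_D k(x,y)\,\rho(dx)=0$ for all $y\in D$, and $k(x,x)>0$ for all $x\in D$. Let $(\gamma_u)_{u\in\mathcal U}$ be non-negative weights with $\gamma_\emptyset=1$ and $\sum_u\gamma_uM^{|u|}<\infty$. Put $k_u(x,y)=\prod_{j\in u}k(x_j,y_j)$, $\mathfrak X=\{x\in D^{\mathbb N}:\sum_u\gamma_uk_u(x,x)<\infty\}$, $K=\sum_{u\in\mathcal U}\gamma_uk_u$ on $\mathfrak X\times\mathfrak X$, and $K_{\{1\}}=1+\gamma_{\{1\}}k_{\{1\}}$ on $D^{\mathbb N}\times D^{\mathbb N}$. $B(\cdot)$ denotes the unit ball of the reproducing kernel Hilbert space with the given kernel; functions in $B(K)$ are extended by $0$ to $D^{\mathbb N}$. Let $I(f)=\int f\,d\mu$.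 **Algorithms, cost, error.** A randomized algorithm $Q$ is a random adaptive algorithm that uses finitely many function values, whose output, number of evaluations and cost are random variables. Its error on a class $F$ is $e(Q,F)=(\sup_{f\in F}\mathbb E(I(f)-Q(f))^2)^{1/2}$. Let $\$:\mathbb N\cup\{0\}\to[0,\infty)$ be non-decreasing, and let $\mathcal A\subseteq\mathfrak X$ be the set of admissible anchors. For $v\in\mathcal U$ and $b\in\mathcal A$ let $\mathfrak X_{v,b}=\{x\in D^{\mathbb N}:x_j=b_j\ \forall j\notin v\}$. In fixed subspace sampling the cost functions are $c(x)=\$(|v|)$ if $x\in\mathfrak X_{v,b}$ and $c(x)=\infty$ otherwise ($v\in\mathcal U$, $b\in\mathcal A$). In variable subspace sampling they are $c(x)=\inf\{\$(|v_i|):x\in\mathfrak X_{v_i,b}\}$, for $b\in\mathcal A$ and strictly increasing sequences of non-empty sets $v_i\in\mathcal U$. The cost of $Q$ at $f$ is the sum of the costs of all evaluations, and its worst case cost on $F$ is $\inf_c\sup_{f\in F}\mathbb E\,\mathrm{cost}_c(Q,f)$, with $c$ ranging over the respective class. Let $e_{N,\mathrm{fix}}(F)$ and $e_{N,\mathrm{var}}(F)$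 be the infima of $e(Q,F)$ over all $Q$ of worst case cost at most $N$ ($N\in\mathbb R$), and let $e_N(F)$ be the infimum over all $Q$ whose worst case expected number of evaluations is at most $N$. **Weights.** $\gamma$ are *product weights* if $\gamma_u=\prod_{j\in u}\gamma_j$ for some $\gamma_1\ge\gamma_2\ge\dots\ge0$. They are *finite-intersection weights* if there are $\omega,r\in\mathbb N$ such that $\gamma_u=0$ whenever $|u|>\omega$, and $|\{v:\gamma_v>0,\ u\cap v\ne\emptyset\}|\le1+r$ whenever $\gamma_u>0$. Fix $a\in D$ with $\mathbf a=(a,a,\dots)\in\mathfrak X$, put $\widehat\gamma_u=\gamma_uk(a,a)^{|u|}$, let $u_1,u_2,\dots$ be an ordering of the non-empty $u$ with $\gamma_u>0$ for which $\widehat\gamma_{u_1}\ge\widehat\gamma_{u_2}\ge\cdots$, and let $\mathrm{decay}_\gamma=\sup\{p\in\mathbb R:\lim_{j\to\infty}\widehat\gamma_{u_j}j^p=0\}$ (which is $\infty$ if only finitely many weights are positive). **Corollary.** Let $\gamma$ be finite-intersection weights or product weights. In the case of finite-intersection weights assume in addition that $\gamma_u\ge\gamma_v$ whenever $u\subseteq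 v$ and $\gamma_u>0$, that $\gamma_{\{1\}}>0$, and that all admissible anchors are of the form $(t,t,\dots)$ with $t\in D$. Let $s>0$ and $c_0>0$ with $\$(\nu)\ge c_0\nu^s$ for all $\nu\ge1$, let $p>\mathrm{decay}_\gamma$, and assume that there is an $\alpha>0$ with $e_N(B(K_{\{1\}}))^2=\Omega(N^{-\alpha})$ as $N\to\infty$. (i) There is a $c>0$ such that $$e_{N,\mathrm{fix}}(B(K))^2\ge c\,N^{-\frac{\alpha(p-1)}{\alpha s+p-1}}\quad\text{for arbitrarily large }N,$$ and a $c>0$ such that $$e_{N,\mathrm{var}}(B(K))^2\ge c\,N^{-\min\{\alpha,\frac{p-1}{s}\}}\quad\text{for arbitrarily large }N.$$ (ii) Suppose moreover that the weights are bounded below by a multiple of $j^{-p}$ throughout, that is, $\widehat\gamma_{u_j}=\Omega(j^{-p})$ in the case of finite-intersection weights, or $\gamma_{\{j\}}=\Omega(j^{-p})$ in the case of product weights. (For instance, this holds for all $p>\mathrm{decay}_\gamma$ if $\lim_{j}\log(1/\widehat\gamma_{u_j})/\log j$, respectively $\lim_j\log(1/\gamma_{\{j\}})/\log j$, exists.)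 Then, as $N\to\infty$, $$e_{N,\mathrm{fix}}(B(K))^2=\Omega\Big(N^{-\frac{\alpha(p-1)}{\alpha s+p-1}}\Big)\quad\text{and}\quad e_{N,\mathrm{var}}(B(K))^2=\Omega\Big(N^{-\min\{\alpha,\frac{p-1}{s}\}}\Big).$$ -/

import Mathlib

open MeasureTheory Filter Topology
open scoped NNReal ENNReal

/-! ### Randomized algorithms, cost and error -/

/-- A deterministic, adaptive algorithm using function values on the domain `X`.
Given the list of the function values obtained so far, it decides whether to end (`finished`), at which
point to evaluate the integrand next (`query`), and what to return (`output`). -/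
structure DetAlgorithm (X : Type) where
  query : List ℝ → X
  finished : List ℝ → Prop
  output : List ℝ → ℝ

namespace DetAlgorithm

variable {X : Type}

/-- The list of the first `n` function values obtained when the algorithm is run on `f`. -/
def answers (A : DetAlgorithm X) (f : X → ℝ) : ℕ → List ℝ
  | 0 => []
  | n + 1 => A.answers f n ++ [f (A.query (A.answers f n))]

/-- The algorithm terminates on the input `f`. -/
def Halts (A : DetAlgorithm X) (f : X → ℝ) : Prop := ∃ n, A.finished (A.answers f n)

/-- The number of function evaluations used on the input `f`. -/
noncomputable def numEvals (A : DetAlgorithm X) (f : X → ℝ) : ℕ :=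
  sInf {n | A.finished (A.answers f n)}

/-- The result returned on the input `f`. -/
noncomputable def value (A : DetAlgorithm X) (f : X → ℝ) : ℝ :=
  A.output (A.answers f (A.numEvals f))

/-- The total cost of all function evaluations made on the input `f`, where an evaluation at the
point `x` costs `c x`. -/
noncomputable def cost (A : DetAlgorithm X) (c : X → ℝ≥0∞) (f : X → ℝ) : ℝ≥0∞ :=
  ∑ i ∈ Finset.range (A.numEvals f), c (A.query (A.answers f i))

end DetAlgorithm

/-- A randomized algorithm on the class `F` of integrands (with respect to the family `C` of
cost functions): a random deterministic algorithm that terminates almost surely on every `f ∈ F` and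
for which output, number of evaluations and costs are random variables. -/
structure RandAlgorithm {X : Type} (F : Set (X → ℝ)) (C : Set (X → ℝ≥0∞)) where
  Ω : Type
  [measurableSpace : MeasurableSpace Ω]
  P : Measure Ω
  [isProbabilityMeasure : IsProbabilityMeasure P]
  alg : Ω → DetAlgorithm X
  halts : ∀ f ∈ F, ∀ᵐ ω ∂P, (alg ω).Halts f
  aemeasurable_value : ∀ f ∈ F, AEMeasurable (fun ω => (alg ω).value f) P
  aemeasurable_numEvals : ∀ f ∈ F, AEMeasurable (fun ω => (alg ω).numEvals f) P
  aemeasurable_cost : ∀ c ∈ C, ∀ f ∈ F, AEMeasurable (fun ω => (alg ω).cost c f) P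

namespace RandAlgorithm

variable {X : Type} {F : Set (X → ℝ)} {C : Set (X → ℝ≥0∞)}

attribute [instance] measurableSpace isProbabilityMeasure

/-- Worst case cost `inf_{c ∈ C} sup_{f ∈ F} 𝔼 (cost_c(Q, f))`. -/
noncomputable def worstCost (Q : RandAlgorithm F C) : ℝ≥0∞ :=
  ⨅ c ∈ C, ⨆ f ∈ F, ∫⁻ ω, (Q.alg ω).cost c f ∂Q.P

/-- Randomized error `(sup_{f ∈ F} 𝔼 ((I f - Q f)²))^{1/2}`. -/
noncomputable def error (Q : RandAlgorithm F C) (I : (X → ℝ) → ℝ) : ℝ≥0∞ :=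
  (⨆ f ∈ F, ∫⁻ ω, ENNReal.ofReal ((I f - (Q.alg ω).value f) ^ 2) ∂Q.P) ^ (1 / 2 : ℝ)

end RandAlgorithm

/-- The `N`th minimal error for approximating `I` on `F`, if the admissible cost functions
are those in `C`. -/
noncomputable def minError {X : Type} (F : Set (X → ℝ)) (C : Set (X → ℝ≥0∞))
    (I : (X → ℝ) → ℝ) (N : ℝ) : ℝ≥0∞ :=
  ⨅ (Q : RandAlgorithm F C) (_ : Q.worstCost ≤ ENNReal.ofReal N), Q.error I

/-! ### Function spaces -/

/-- The norm unit ball `B(K)` of the reproducing kernel Hilbert space `H(K)`, as a set of functions: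
`H(K)` is the Hilbert space of functions whose reproducing kernel is `K` (it is unique). -/
def rkhsUnitBall {X : Type} (K : X → X → ℝ) : Set (X → ℝ) :=
  {f | ∃ (H : Type) (_ : NormedAddCommGroup H) (_ : InnerProductSpace ℝ H) (_ : CompleteSpace H)
      (_ : RKHS ℝ H X ℝ), (∀ x y, RKHS.kernel H x y 1 = K x y) ∧ ∃ h : H, ‖h‖ ≤ 1 ∧ ⇑h = f}

section Spaces

variable {D : Set ℝ}

/-- `k_u(x, y) = ∏_{j ∈ u} k(x_j, y_j)`. -/
def prodKernel (k : D → D → ℝ) (u : Finset ℕ+) (x y : ℕ+ → D) : ℝ :=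
  ∏ j ∈ u, k (x j) (y j)

/-- `K_v(x, y) = ∑_{u ⊆ v} γ_u k_u(x, y)` on `D^ℕ`. -/
def weightedKernel (k : D → D → ℝ) (γ : Finset ℕ+ → ℝ) (v : Finset ℕ+) (x y : ℕ+ → D) : ℝ :=
  ∑ u ∈ v.powerset, γ u * prodKernel k u x y

/-- The domain `𝔛` of the functions of infinitely many variables. -/
def infDomain (k : D → D → ℝ) (γ : Finset ℕ+ → ℝ) : Set (ℕ+ → D) :=
  {x | Summable fun u : Finset ℕ+ => γ u * prodKernel k u x x}

/-- `K(x, y) = ∑_u γ_u k_u(x, y)` on `𝔛`. -/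
noncomputable def infKernel (k : D → D → ℝ) (γ : Finset ℕ+ → ℝ) (x y : infDomain k γ) : ℝ :=
  ∑' u : Finset ℕ+, γ u * prodKernel k u x y

/-- The unit ball `B(K)`; its elements are extended by zero from `𝔛` to `D^ℕ`. -/
def infUnitBall (k : D → D → ℝ) (γ : Finset ℕ+ → ℝ) : Set ((ℕ+ → D) → ℝ) :=
  {f | (∀ x ∉ infDomain k γ, f x = 0) ∧
    (fun x : infDomain k γ => f x) ∈ rkhsUnitBall (infKernel k γ)}

/-- Integration with respect to the product measure `μ = ⊗ ρ` on `D^ℕ`. -/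
noncomputable def infIntegral (ρ : Measure D) (f : (ℕ+ → D) → ℝ) : ℝ :=
  ∫ x, f x ∂(Measure.infinitePi fun _ : ℕ+ => ρ)

/-! ### Cost models -/

/-- The affine subspace `𝔛_{v,a}` of all points that agree with the anchor `a` outside `v`. -/
def anchoredSubspace (v : Finset ℕ+) (a : ℕ+ → D) : Set (ℕ+ → D) :=
  {x | ∀ j ∉ v, x j = a j}

open Classical in
/-- The cost function `c_{v,a}` of fixed subspace sampling. -/
noncomputable def fixedCost (price : ℕ → ℝ≥0) (v : Finset ℕ+) (a : ℕ+ → D) (x : ℕ+ → D) : ℝ≥0∞ :=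
  if x ∈ anchoredSubspace v a then (price v.card : ℝ≥0∞) else ⊤

/-- The cost function of variable subspace sampling. -/
noncomputable def varCost (price : ℕ → ℝ≥0) (v : ℕ → Finset ℕ+) (a : ℕ+ → D) (x : ℕ+ → D) :
    ℝ≥0∞ :=
  ⨅ (i : ℕ) (_ : x ∈ anchoredSubspace (v i) a), (price (v i).card : ℝ≥0∞)

/-- All cost functions of fixed subspace sampling with anchors in `𝒜`. -/
def fixedCosts (price : ℕ → ℝ≥0) (𝒜 : Set (ℕ+ → D)) : Set ((ℕ+ → D) → ℝ≥0∞) :=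
  {c | ∃ v : Finset ℕ+, ∃ a ∈ 𝒜, c = fixedCost price v a}

/-- All cost functions of variable subspace sampling with anchors in `𝒜`. -/
def varCosts (price : ℕ → ℝ≥0) (𝒜 : Set (ℕ+ → D)) : Set ((ℕ+ → D) → ℝ≥0∞) :=
  {c | ∃ v : ℕ → Finset ℕ+, StrictMono v ∧ (∀ i, (v i).Nonempty) ∧
    ∃ a ∈ 𝒜, c = varCost price v a}

/-- `e_{N,fix}(B(K))`. -/
noncomputable def fixedMinError (k : D → D → ℝ) (ρ : Measure D) (γ : Finset ℕ+ → ℝ)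
    (price : ℕ → ℝ≥0) (𝒜 : Set (ℕ+ → D)) (N : ℝ) : ℝ≥0∞ :=
  minError (infUnitBall k γ) (fixedCosts price 𝒜) (infIntegral ρ) N

/-- `e_{N,var}(B(K))`. -/
noncomputable def varMinError (k : D → D → ℝ) (ρ : Measure D) (γ : Finset ℕ+ → ℝ)
    (price : ℕ → ℝ≥0) (𝒜 : Set (ℕ+ → D)) (N : ℝ) : ℝ≥0∞ :=
  minError (infUnitBall k γ) (varCosts price 𝒜) (infIntegral ρ) N

/-- `e_N(B(K_{{1}}))`: every function evaluation has cost one, so that the worst case cost is the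
worst case expected number of evaluations. -/
noncomputable def univariateMinError (k : D → D → ℝ) (ρ : Measure D) (γ : Finset ℕ+ → ℝ)
    (N : ℝ) : ℝ≥0∞ :=
  minError (rkhsUnitBall (weightedKernel k γ {1})) {fun _ => 1} (infIntegral ρ) N

end Spaces

/-! ### Weights -/

/-- Product weights `γ_u = ∏_{j ∈ u} γ_j` with `γ_1 ≥ γ_2 ≥ ⋯ ≥ 0`. -/
def IsProductWeights (γ : Finset ℕ+ → ℝ) : Prop :=
  ∃ g : ℕ+ → ℝ, (∀ j, 0 ≤ g j) ∧ Antitone g ∧ ∀ u, γ u = ∏ j ∈ u, g j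

/-- Finite-order weights that have some finite intersection degree. -/
def IsFiniteIntersectionWeights (γ : Finset ℕ+ → ℝ) : Prop :=
  (∃ ω : ℕ, ∀ u : Finset ℕ+, ω < u.card → γ u = 0) ∧
  ∃ r : ℕ, ∀ u, 0 < γ u → {v | 0 < γ v ∧ (u ∩ v).Nonempty}.encard ≤ 1 + (r : ℕ∞)

/-- The condition `γ_u ≥ γ_v` for all `u ⊆ v` with `γ_u > 0`. -/
def MonotonicityCondition (γ : Finset ℕ+ → ℝ) : Prop :=
  ∀ u v, u ⊆ v → 0 < γ u → γ v ≤ γ u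

section Decay

variable {D : Set ℝ}

/-- `γ̂_u = γ_u k_u(a, a)`. -/
def anchoredWeight (k : D → D → ℝ) (γ : Finset ℕ+ → ℝ) (a : ℕ+ → D) (u : Finset ℕ+) : ℝ :=
  γ u * prodKernel k u a a

/-- `e` lists (without repetition) the non-empty sets `u` with `γ_u > 0` in such a way that `γ̂_u`
is non-increasing. -/
def IsDecreasingListing (k : D → D → ℝ) (γ : Finset ℕ+ → ℝ) (a : ℕ+ → D)
    (e : ℕ+ → Finset ℕ+) : Prop :=
  Function.Injective e ∧ Set.range e = {u | u.Nonempty ∧ 0 < γ u} ∧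
    Antitone fun j => anchoredWeight k γ a (e j)

/-- `decay_γ = sup {p | lim_j γ̂_{u_j} j^p = 0}`; it does not depend on the chosen ordering, and it
is `⊤` if only finitely many weights are positive. -/
noncomputable def decay (k : D → D → ℝ) (γ : Finset ℕ+ → ℝ) (a : ℕ+ → D) : EReal :=
  sSup {x | ∃ p : ℝ, x = (p : EReal) ∧ ∀ e, IsDecreasingListing k γ a e →
    Tendsto (fun j : ℕ+ => anchoredWeight k γ a (e j) * ((j : ℕ) : ℝ) ^ p) atTop (𝓝 0)}

/-- The weights are bounded below by a constant times `j^{-p}` throughout, and not only along a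
subsequence: `γ̂_{u_j} = Ω(j^{-p})` for finite-intersection weights, `γ_{{j}} = Ω(j^{-p})` for product
weights. -/
def PolynomialLowerBound (k : D → D → ℝ) (γ : Finset ℕ+ → ℝ) (a : ℕ+ → D) (p : ℝ) : Prop :=
  (IsFiniteIntersectionWeights γ ∧ ∀ e, IsDecreasingListing k γ a e →
    ∃ c > 0, ∀ j : ℕ+, c * ((j : ℕ) : ℝ) ^ (-p) ≤ anchoredWeight k γ a (e j)) ∨
  (IsProductWeights γ ∧ ∃ c > 0, ∀ j : ℕ+, c * ((j : ℕ) : ℝ) ^ (-p) ≤ γ {j})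

end Decay

/-! Two lower bounds hold for every algorithm of cost about `N`; the rates come from combining them.

Univariate bound (`le_error_sq_of_univariate`): the kernel for `{1}` is a partial sum of `K`, so the
functions of its unit ball, truncated to `𝔛`, lie in `B(K)` and keep their integrals. If every
evaluation costs at least `q`, at most `N / q` evaluations are expected, and the squared error is at
least of order `(N / q)^(-α)`.

Fooling bound (`le_error_sq_of_hasTailWeights`): suppose that all points of cost below `4 * N` lie
in `𝔛_{v,b}` with `|v| ≤ m`. For a finite family `U` of non-empty sets disjoint from `v`, put `S =
∑_{u ∈ U} γ_u k_u(b, b)`. The function `S - ∑_{u ∈ U} γ_u k_u(·, b)` vanishes on `𝔛_{v,b}`, has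
integral `S` and squared norm at most `S² + S`. After normalization it cannot be told from its
negative at low cost, so the squared error is at least of order `min S 1`. Few of the heaviest sets
meet `v`, whence `S ≥ c * m^(1-p)` for suitable `U` (`exists_hasTailWeights`).

The decay is measured at `a`, but anchors are arbitrary. The transfer needs `inf k(x, x) > 0`, which
follows from the univariate assumption: a single evaluation at `x` has squared error at most `γ_{1}
k(x, x)`, while the first minimal error is positive (`exists_kernel_lower_bound`).

Fixed subspaces: either `|v| ≤ m` and the error is at least `m^(1-p)`, or each evaluation costs at
least `c₀ * m^s` and it is at least `(N / m^s)^(-α)`, up to constants; `m = N^(α/(αs+p-1))` balances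
the two. Variable subspaces: every point costs at least `c₀`, which gives `N^(-α)`, and the
affordable points lie in one subspace with `m` of order `N^(1/s)`, which gives `N^(-(p-1)/s)`; the
larger bound wins. -/

/-! ### Positive semidefinite kernels and the unit ball of their Hilbert spaces -/

section Kernels

variable {X : Type}

/-- The operator valued kernel on `ℝ` that belongs to a real valued kernel. -/
noncomputable def operatorKernel (K : X → X → ℝ) : Matrix X X (ℝ →L[ℝ] ℝ) :=
  Matrix.of fun x y => K x y • (1 : ℝ →L[ℝ] ℝ)

theorem posSemidef_operatorKernel {K : X → X → ℝ} (hK : (Matrix.of K).PosSemidef) :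
    (operatorKernel K).PosSemidef := by
  have key : (operatorKernel K).PosSemidef ↔ (operatorKernel K).IsHermitian ∧ ∀ vv : X →₀ ℝ,
      0 ≤ RCLike.re (vv.sum fun x w => vv.sum fun x' w' =>
        inner ℝ (operatorKernel K x' x w) w') := RKHS.posSemidef_tfae.out 0 2
  refine key.2 ⟨?_, fun w => ?_⟩
  · ext1 x y
    have := hK.1.apply x y
    simp only [Matrix.of_apply, star_trivial] at this
    ext
    simp [operatorKernel, this]
  · have := hK.2 w
    simp only [Matrix.of_apply, star_trivial] at this
    rw [Finsupp.sum_comm] at this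
    simpa [operatorKernel, mul_comm, mul_left_comm, mul_assoc] using this

/-- Moore's theorem for real valued kernels. -/
theorem exists_rkhs_of_posSemidef {K : X → X → ℝ} (hK : (Matrix.of K).PosSemidef) :
    ∃ (H : Type) (_ : NormedAddCommGroup H) (_ : InnerProductSpace ℝ H) (_ : CompleteSpace H)
      (_ : RKHS ℝ H X ℝ), ∀ x y, RKHS.kernel H x y 1 = K x y := by
  have : Fact (operatorKernel K).PosSemidef := ⟨posSemidef_operatorKernel hK⟩
  refine ⟨RKHS.OfKernel (operatorKernel K), inferInstance, inferInstance, inferInstance,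
    inferInstance, fun x y => ?_⟩
  rw [RKHS.OfKernel.kernel_ofKernel]
  simp [operatorKernel]

theorem rkhs_inner_kerFun_kerFun {H : Type} [NormedAddCommGroup H] [InnerProductSpace ℝ H]
    [CompleteSpace H] [RKHS ℝ H X ℝ] (x y : X) :
    inner ℝ (RKHS.kerFun H x (1 : ℝ)) (RKHS.kerFun H y (1 : ℝ)) = RKHS.kernel H x y 1 := by
  rw [RKHS.kerFun_inner, RKHS.kerFun_apply]
  simp

theorem rkhs_inner_kerFun {H : Type} [NormedAddCommGroup H] [InnerProductSpace ℝ H]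
    [CompleteSpace H] [RKHS ℝ H X ℝ] (x : X) (h : H) :
    inner ℝ (RKHS.kerFun H x (1 : ℝ)) h = h x := by
  rw [RKHS.kerFun_inner]
  simp

/-- Realizing `K` as a Gram kernel turns the inequalities below into Hilbert space geometry, also
for families with repeated points. -/
theorem exists_featureMap {K : X → X → ℝ} (hK : (Matrix.of K).PosSemidef) :
    ∃ (E : Type) (_ : NormedAddCommGroup E) (_ : InnerProductSpace ℝ E) (φ : X → E),
      ∀ x y, inner ℝ (φ x) (φ y) = K x y := by
  obtain ⟨H, _, _, _, _, hH⟩ := exists_rkhs_of_posSemidef hK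
  exact ⟨H, _, _, fun x => RKHS.kerFun H x 1, fun x y => by rw [rkhs_inner_kerFun_kerFun, hH]⟩

theorem norm_sum_smul_sq {E ι : Type} [NormedAddCommGroup E] [InnerProductSpace ℝ E]
    (t : Finset ι) (a : ι → ℝ) (w : ι → E) :
    ‖∑ i ∈ t, a i • w i‖ ^ 2 = ∑ i ∈ t, ∑ j ∈ t, a i * a j * inner ℝ (w i) (w j) := by
  rw [← real_inner_self_eq_norm_sq, sum_inner]
  refine Finset.sum_congr rfl fun i _ => ?_
  rw [inner_sum]
  refine Finset.sum_congr rfl fun j _ => ?_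
  rw [real_inner_smul_left, real_inner_smul_right]
  ring

theorem posSemidef_quadForm_nonneg {K : X → X → ℝ} (hK : (Matrix.of K).PosSemidef) {ι : Type}
    (t : Finset ι) (a : ι → ℝ) (x : ι → X) :
    0 ≤ ∑ i ∈ t, ∑ j ∈ t, a i * a j * K (x i) (x j) := by
  obtain ⟨E, _, _, φ, hφ⟩ := exists_featureMap hK
  have := norm_sum_smul_sq t a fun i => φ (x i)
  simp only [hφ] at this
  rw [← this]
  positivity

theorem posSemidef_cauchySchwarz {K : X → X → ℝ} (hK : (Matrix.of K).PosSemidef) {ι : Type}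
    (t : Finset ι) (a : ι → ℝ) (x : ι → X) (b : X) :
    (∑ i ∈ t, a i * K (x i) b) ^ 2 ≤ K b b * ∑ i ∈ t, ∑ j ∈ t, a i * a j * K (x i) (x j) := by
  obtain ⟨E, _, _, φ, hφ⟩ := exists_featureMap hK
  have h1 := norm_sum_smul_sq t a fun i => φ (x i)
  have h2 : inner ℝ (∑ i ∈ t, a i • φ (x i)) (φ b) = ∑ i ∈ t, a i * K (x i) b := by
    rw [sum_inner]
    exact Finset.sum_congr rfl fun i _ => by rw [real_inner_smul_left, hφ]
  have h3 : ‖φ b‖ ^ 2 = K b b := by rw [← real_inner_self_eq_norm_sq, hφ]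
  simp only [hφ] at h1
  rw [← h1, ← h2, ← h3, ← mul_pow, mul_comm, ← sq_abs]
  gcongr
  exact abs_real_inner_le_norm _ _

theorem posSemidef_symm {K : X → X → ℝ} (hK : (Matrix.of K).PosSemidef) (x y : X) :
    K x y = K y x := by
  simpa using hK.1.apply y x

theorem posSemidef_abs_le {K : X → X → ℝ} (hK : (Matrix.of K).PosSemidef) (x y : X) :
    |K x y| ≤ (K x x + K y y) / 2 := by
  obtain ⟨E, _, _, φ, hφ⟩ := exists_featureMap hK
  have h := abs_real_inner_le_norm (φ x) (φ y)
  rw [hφ] at h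
  have hx : ‖φ x‖ ^ 2 = K x x := by rw [← real_inner_self_eq_norm_sq, hφ]
  have hy : ‖φ y‖ ^ 2 = K y y := by rw [← real_inner_self_eq_norm_sq, hφ]
  nlinarith [sq_nonneg (‖φ x‖ - ‖φ y‖)]

theorem posSemidef_diag_nonneg {K : X → X → ℝ} (hK : (Matrix.of K).PosSemidef) (x : X) :
    0 ≤ K x x := by
  have := (abs_nonneg _).trans (posSemidef_abs_le hK x x)
  linarith

theorem posSemidef_of_quadForm_nonneg {K : X → X → ℝ} (hs : ∀ x y, K x y = K y x)
    (h : ∀ (t : Finset X) (a : X → ℝ), 0 ≤ ∑ i ∈ t, ∑ j ∈ t, a i * a j * K i j) :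
    (Matrix.of K).PosSemidef := by
  refine ⟨?_, fun w => ?_⟩
  · ext x y
    simpa using hs y x
  · have := h w.support w
    simp only [Finsupp.sum, Matrix.of_apply, star_trivial]
    refine this.trans_eq (Finset.sum_congr rfl fun i _ => Finset.sum_congr rfl fun j _ => ?_)
    ring

theorem rkhsUnitBall_sq_le {K : X → X → ℝ} {f : X → ℝ} (hf : f ∈ rkhsUnitBall K) {ι : Type}
    (t : Finset ι) (a : ι → ℝ) (x : ι → X) :
    (∑ i ∈ t, a i * f (x i)) ^ 2 ≤ ∑ i ∈ t, ∑ j ∈ t, a i * a j * K (x i) (x j) := by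
  obtain ⟨H, _, _, _, _, hH, h, hh, rfl⟩ := hf
  have h1 := norm_sum_smul_sq t a fun i => RKHS.kerFun H (x i) (1 : ℝ)
  simp only [rkhs_inner_kerFun_kerFun, hH] at h1
  have h2 : inner ℝ (∑ i ∈ t, a i • RKHS.kerFun H (x i) (1 : ℝ)) h = ∑ i ∈ t, a i * h (x i) := by
    rw [sum_inner]
    exact Finset.sum_congr rfl fun i _ => by rw [real_inner_smul_left, rkhs_inner_kerFun]
  rw [← h1, ← h2, ← sq_abs]
  gcongr
  refine (abs_real_inner_le_norm _ _).trans ?_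
  exact mul_le_of_le_one_right (norm_nonneg _) hh

/-- The bound makes `l` factor through the range of `T` as a functional of norm at most one;
Hahn–Banach extends it and Riesz represents it. -/
theorem exists_inner_eq_of_abs_le_norm {V H : Type} [AddCommGroup V] [Module ℝ V]
    [NormedAddCommGroup H] [InnerProductSpace ℝ H] [CompleteSpace H]
    (T : V →ₗ[ℝ] H) (l : V →ₗ[ℝ] ℝ) (h : ∀ a, |l a| ≤ ‖T a‖) :
    ∃ g : H, ‖g‖ ≤ 1 ∧ ∀ a, inner ℝ g (T a) = l a := by
  have hker : LinearMap.ker T ≤ LinearMap.ker l := fun a ha => by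
    have := h a
    rw [LinearMap.mem_ker.1 ha, norm_zero] at this
    exact LinearMap.mem_ker.2 (abs_nonpos_iff.1 this)
  let ψ : LinearMap.range T →ₗ[ℝ] ℝ :=
    ((LinearMap.ker T).liftQ l hker).comp T.quotKerEquivRange.symm.toLinearMap
  have hψ : ∀ a, ψ ⟨T a, a, rfl⟩ = l a := fun a => by
    have : T.quotKerEquivRange.symm ⟨T a, a, rfl⟩ = (LinearMap.ker T).mkQ a := by
      rw [LinearEquiv.symm_apply_eq]
      rfl
    simp [ψ, this]
  let ψ' : LinearMap.range T →L[ℝ] ℝ := ψ.mkContinuous 1 (by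
    rintro ⟨_, a, rfl⟩
    rw [hψ, one_mul]
    exact h a)
  obtain ⟨Ψ, hΨ, hn⟩ := exists_extension_norm_eq (LinearMap.range T) ψ'
  refine ⟨(InnerProductSpace.toDual ℝ H).symm Ψ, ?_, fun a => ?_⟩
  · rw [LinearIsometryEquiv.norm_map, hn]
    exact LinearMap.mkContinuous_norm_le _ zero_le_one _
  · rw [InnerProductSpace.toDual_symm_apply, ← hψ a]
    exact hΨ ⟨T a, a, rfl⟩

/-- The hypothesis says that `∑ a_i K(·, x_i) ↦ ∑ a_i f(x_i)` has norm at most one, so a vector of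
the unit ball represents it, and this vector is `f`. It also forces `K` to be positive semidefinite.
All membership proofs thus reduce to comparing quadratic forms. -/
theorem mem_rkhsUnitBall_of_sq_le {K : X → X → ℝ} (hs : ∀ x y, K x y = K y x) {f : X → ℝ}
    (hf : ∀ (t : Finset X) (a : X → ℝ),
      (∑ i ∈ t, a i * f i) ^ 2 ≤ ∑ i ∈ t, ∑ j ∈ t, a i * a j * K i j) :
    f ∈ rkhsUnitBall K := by
  have hK := posSemidef_of_quadForm_nonneg hs fun t a => (sq_nonneg _).trans (hf t a)
  obtain ⟨H, _, _, _, _, hH⟩ := exists_rkhs_of_posSemidef hK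
  let T : (X →₀ ℝ) →ₗ[ℝ] H := Finsupp.linearCombination ℝ fun x => RKHS.kerFun H x (1 : ℝ)
  let l : (X →₀ ℝ) →ₗ[ℝ] ℝ := Finsupp.linearCombination ℝ f
  obtain ⟨g, hg, hgl⟩ := exists_inner_eq_of_abs_le_norm T l fun a => by
    have h1 := norm_sum_smul_sq a.support a fun x => RKHS.kerFun H x (1 : ℝ)
    simp only [rkhs_inner_kerFun_kerFun, hH] at h1
    refine abs_le_of_sq_le_sq' ?_ (norm_nonneg _) |> abs_le.2
    simp only [T, l, Finsupp.linearCombination_apply, Finsupp.sum]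
    rw [h1]
    simpa using hf a.support a
  refine ⟨H, _, _, _, _, hH, g, hg, funext fun x => ?_⟩
  have := hgl (Finsupp.single x 1)
  simp only [T, l, Finsupp.linearCombination_single, one_smul] at this
  rw [← this, real_inner_comm, rkhs_inner_kerFun]

end Kernels

/-! ### Weighted sums of product kernels -/

section WeightedKernels

variable {D : Set ℝ} {k : D → D → ℝ} {γ : Finset ℕ+ → ℝ}

theorem posSemidef_one (X : Type) : (Matrix.of fun _ _ : X => (1 : ℝ)).PosSemidef := by
  refine posSemidef_of_quadForm_nonneg (fun _ _ => rfl) fun t a => ?_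
  simp only [mul_one, ← Finset.mul_sum, ← Finset.sum_mul]
  exact mul_self_nonneg _

@[simp]
theorem prodKernel_empty (x y : ℕ+ → D) : prodKernel k ∅ x y = 1 := rfl

@[simp]
theorem prodKernel_singleton (j : ℕ+) (x y : ℕ+ → D) : prodKernel k {j} x y = k (x j) (y j) := by
  simp [prodKernel]

/-- Schur's product theorem, one coordinate at a time. -/
theorem posSemidef_prodKernel (hk : (Matrix.of k).PosSemidef) (u : Finset ℕ+) :
    (Matrix.of (prodKernel k u)).PosSemidef := by
  induction u using Finset.induction_on with
  | empty => exact posSemidef_one _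
  | insert j u hj ih =>
    have h1 : (Matrix.of fun x y : ℕ+ → D => k (x j) (y j)).PosSemidef :=
      hk.submatrix fun x : ℕ+ → D => x j
    convert! h1.hadamard ih using 1
    ext x y
    simp [prodKernel, hj]

theorem prodKernel_self_pos (hk_pos : ∀ a, 0 < k a a) (u : Finset ℕ+) (x : ℕ+ → D) :
    0 < prodKernel k u x x :=
  Finset.prod_pos fun j _ => hk_pos (x j)

theorem prodKernel_congr {u : Finset ℕ+} {x x' y y' : ℕ+ → D} (h : ∀ j ∈ u, x j = x' j)
    (h' : ∀ j ∈ u, y j = y' j) : prodKernel k u x y = prodKernel k u x' y' :=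
  Finset.prod_congr rfl fun j hj => by rw [h j hj, h' j hj]

theorem summable_weighted_prodKernel (hk : (Matrix.of k).PosSemidef) (hγ : ∀ u, 0 ≤ γ u)
    {x y : ℕ+ → D} (hx : x ∈ infDomain k γ) (hy : y ∈ infDomain k γ) :
    Summable fun u : Finset ℕ+ => γ u * prodKernel k u x y := by
  have hx' : Summable fun u : Finset ℕ+ => γ u * prodKernel k u x x := hx
  have hy' : Summable fun u : Finset ℕ+ => γ u * prodKernel k u y y := hy
  refine Summable.of_norm_bounded ((hx'.add hy').div_const 2) fun u => ?_
  rw [Real.norm_eq_abs, abs_mul, abs_of_nonneg (hγ u), ← mul_add, mul_div_assoc]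
  exact mul_le_mul_of_nonneg_left (posSemidef_abs_le (posSemidef_prodKernel hk u) x y) (hγ u)

theorem infKernel_symm (hk : (Matrix.of k).PosSemidef) (x y : infDomain k γ) :
    infKernel k γ x y = infKernel k γ y x :=
  tsum_congr fun u => by rw [posSemidef_symm (posSemidef_prodKernel hk u)]

/-- Every term dropped from the series is a non-negative quadratic form. -/
theorem sum_quadForm_le_infKernel (hk : (Matrix.of k).PosSemidef) (hγ : ∀ u, 0 ≤ γ u)
    (V : Finset (Finset ℕ+)) {ι : Type} (t : Finset ι) (a : ι → ℝ) (x : ι → infDomain k γ) :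
    ∑ u ∈ V, γ u * ∑ i ∈ t, ∑ j ∈ t, a i * a j * prodKernel k u (x i) (x j) ≤
      ∑ i ∈ t, ∑ j ∈ t, a i * a j * infKernel k γ (x i) (x j) := by
  have h : HasSum (fun u => ∑ i ∈ t, ∑ j ∈ t, a i * a j * (γ u * prodKernel k u (x i) (x j)))
      (∑ i ∈ t, ∑ j ∈ t, a i * a j * infKernel k γ (x i) (x j)) :=
    hasSum_sum fun i _ => hasSum_sum fun j _ =>
      (summable_weighted_prodKernel hk hγ (x i).2 (x j).2).hasSum.mul_left _
  have h' : ∀ u, γ u * ∑ i ∈ t, ∑ j ∈ t, a i * a j * prodKernel k u (x i) (x j) =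
      ∑ i ∈ t, ∑ j ∈ t, a i * a j * (γ u * prodKernel k u (x i) (x j)) := fun u => by
    simp only [Finset.mul_sum]
    exact Finset.sum_congr rfl fun i _ => Finset.sum_congr rfl fun j _ => by ring
  simp only [← h'] at h
  exact sum_le_hasSum V (fun u _ => mul_nonneg (hγ u)
    (posSemidef_quadForm_nonneg (posSemidef_prodKernel hk u) t a fun i => (x i : ℕ+ → D))) h

theorem indicator_mem_infUnitBall (hk : (Matrix.of k).PosSemidef) {g : (ℕ+ → D) → ℝ}
    (h : ∀ (t : Finset (infDomain k γ)) (a : infDomain k γ → ℝ),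
      (∑ i ∈ t, a i * g i) ^ 2 ≤ ∑ i ∈ t, ∑ j ∈ t, a i * a j * infKernel k γ i j) :
    (infDomain k γ).indicator g ∈ infUnitBall k γ := by
  refine ⟨fun x hx => Set.indicator_of_notMem hx g, ?_⟩
  have : (fun x : infDomain k γ => (infDomain k γ).indicator g x) =
      fun x : infDomain k γ => g x :=
    funext fun x => Set.indicator_of_mem x.2 g
  rw [this]
  exact mem_rkhsUnitBall_of_sq_le (infKernel_symm hk) h

theorem indicator_mem_infUnitBall_of_mem_weightedKernel (hk : (Matrix.of k).PosSemidef)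
    (hγ : ∀ u, 0 ≤ γ u) {v : Finset ℕ+} {g : (ℕ+ → D) → ℝ}
    (hg : g ∈ rkhsUnitBall (weightedKernel k γ v)) :
    (infDomain k γ).indicator g ∈ infUnitBall k γ := by
  refine indicator_mem_infUnitBall hk fun t a => ?_
  refine (rkhsUnitBall_sq_le hg t a fun i => (i : ℕ+ → D)).trans ?_
  refine le_trans (le_of_eq ?_) (sum_quadForm_le_infKernel hk hγ v.powerset t a fun i => i)
  simp only [weightedKernel, Finset.mul_sum]
  rw [Finset.sum_comm (s := v.powerset)]
  refine Finset.sum_congr rfl fun i _ => ?_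
  rw [Finset.sum_comm (s := v.powerset)]
  exact Finset.sum_congr rfl fun j _ => Finset.sum_congr rfl fun u _ => by ring

/-- The function `S - ∑_{u ∈ U} γ_u k_u(·, b)` with `S = ∑_{u ∈ U} γ_u k_u(b, b)`, which vanishes at
all points that agree with `b` on the sets from `U`. -/
noncomputable def foolingFunction (k : D → D → ℝ) (γ : Finset ℕ+ → ℝ) (U : Finset (Finset ℕ+))
    (b x : ℕ+ → D) : ℝ :=
  ∑ u ∈ U, γ u * prodKernel k u b b - ∑ u ∈ U, γ u * prodKernel k u x b

theorem foolingFunction_eq_zero {U : Finset (Finset ℕ+)} {v : Finset ℕ+}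
    (hU : ∀ u ∈ U, Disjoint u v) {b x : ℕ+ → D} (hx : x ∈ anchoredSubspace v b) :
    foolingFunction k γ U b x = 0 := by
  rw [foolingFunction, sub_eq_zero]
  refine Finset.sum_congr rfl fun u hu => ?_
  exact congrArg _ (prodKernel_congr
    (fun j hj => (hx j (Finset.disjoint_left.1 (hU u hu) hj)).symm) fun _ _ => rfl)

/-- The constant `S` contributes at most `S²` to the squared norm because `γ ∅ = 1`, and `∑ γ_u
k_u(·, b)` contributes at most `S`. The contributions add since `∅ ∉ U` puts them into different
summands of the kernel. -/
theorem foolingFunction_mem_infUnitBall (hk : (Matrix.of k).PosSemidef) (hk_pos : ∀ a, 0 < k a a)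
    (hγ : ∀ u, 0 ≤ γ u) (hγ_empty : γ ∅ = 1) {U : Finset (Finset ℕ+)} (hU : ∅ ∉ U)
    (b : ℕ+ → D) {l S : ℝ} (hS : ∑ u ∈ U, γ u * prodKernel k u b b = S)
    (hl : l ^ 2 * (S ^ 2 + S) ≤ 1) :
    ((infDomain k γ).indicator fun x => l * foolingFunction k γ U b x) ∈ infUnitBall k γ := by
  refine indicator_mem_infUnitBall hk fun t a => ?_
  refine le_trans ?_ (sum_quadForm_le_infKernel hk hγ (insert ∅ U) t a fun i => i)
  set A := ∑ i ∈ t, a i with hA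
  let B : Finset ℕ+ → ℝ := fun u => ∑ i ∈ t, a i * prodKernel k u (i : ℕ+ → D) b
  let q : Finset ℕ+ → ℝ := fun u => ∑ i ∈ t, ∑ j ∈ t, a i * a j * prodKernel k u (i : ℕ+ → D) j
  have hq0 : q ∅ = A ^ 2 := by
    simp only [q, prodKernel_empty, mul_one, ← Finset.mul_sum, ← Finset.sum_mul, sq, hA]
  have hB : ∀ u, B u ^ 2 ≤ prodKernel k u b b * q u := fun u =>
    posSemidef_cauchySchwarz (posSemidef_prodKernel hk u) t a _ b
  have hqn : ∀ u, 0 ≤ q u := fun u =>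
    posSemidef_quadForm_nonneg (posSemidef_prodKernel hk u) t a _
  have hsum : ∑ i ∈ t, a i * (l * foolingFunction k γ U b i) = l * (S * A - ∑ u ∈ U, γ u * B u) := by
    simp only [foolingFunction, hS, B, hA]
    simp only [mul_sub, Finset.sum_sub_distrib, Finset.mul_sum]
    congr 1
    · exact Finset.sum_congr rfl fun i _ => by ring
    · rw [Finset.sum_comm]
      exact Finset.sum_congr rfl fun i _ => Finset.sum_congr rfl fun j _ => by ring
  rw [hsum, Finset.sum_insert hU, hγ_empty, one_mul]
  change _ ≤ q ∅ + ∑ u ∈ U, γ u * q u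
  have h1 : (∑ u ∈ U, γ u * B u) ^ 2 ≤ S * ∑ u ∈ U, γ u * q u := by
    rw [← hS]
    refine Finset.sum_sq_le_sum_mul_sum_of_sq_le_mul U
      (fun u _ => mul_nonneg (hγ u) (prodKernel_self_pos hk_pos u b).le)
      (fun u _ => mul_nonneg (hγ u) (hqn u)) fun u _ => ?_
    have := mul_le_mul_of_nonneg_left (hB u) (sq_nonneg (γ u))
    nlinarith
  have hS0 : 0 ≤ S := by
    rw [← hS]
    exact Finset.sum_nonneg fun u _ => mul_nonneg (hγ u) (prodKernel_self_pos hk_pos u b).le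
  set R := ∑ u ∈ U, γ u * B u
  set T := ∑ u ∈ U, γ u * q u
  have hT : 0 ≤ T := Finset.sum_nonneg fun u _ => mul_nonneg (hγ u) (hqn u)
  -- Right side minus left side equals `S * (A + R)² + (S + 1) * (S * T - R²)`.
  have h2 : (S * A - R) ^ 2 ≤ (S ^ 2 + S) * (A ^ 2 + T) := by
    nlinarith [sq_nonneg (S * A + R), sq_nonneg (A + R), mul_nonneg hS0 hT, mul_nonneg hS0 (sq_nonneg (A + R))]
  rw [hq0, mul_pow]
  calc l ^ 2 * (S * A - R) ^ 2 ≤ l ^ 2 * ((S ^ 2 + S) * (A ^ 2 + T)) := by gcongr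
    _ = l ^ 2 * (S ^ 2 + S) * (A ^ 2 + T) := by ring
    _ ≤ 1 * (A ^ 2 + T) := by gcongr
    _ = _ := one_mul _

end WeightedKernels

/-! ### Integration of kernels -/

section Integration

/-- Finite combinations of kernel functions are dense, and norm convergence implies pointwise
convergence. -/
theorem rkhs_measurable {X : Type} [MeasurableSpace X] {H : Type} [NormedAddCommGroup H]
    [InnerProductSpace ℝ H] [CompleteSpace H] [RKHS ℝ H X ℝ]
    (hmeas : ∀ y, Measurable fun x => RKHS.kernel H x y 1) (h : H) : Measurable h := by
  have hspan : ∀ g ∈ Submodule.span ℝ {RKHS.kerFun H x v | (x) (v)}, Measurable g := by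
    intro g hg
    induction hg using Submodule.span_induction with
    | mem g hg =>
      obtain ⟨y, v, rfl⟩ := hg
      have : ⇑(RKHS.kerFun H y v) = fun x => v * RKHS.kernel H x y 1 := by
        ext x
        rw [RKHS.kerFun_apply, ← smul_eq_mul, ← map_smul, smul_eq_mul, mul_one]
      rw [this]
      exact (hmeas y).const_mul v
    | zero => rw [RKHS.coe_zero]; exact measurable_zero
    | add g g' _ _ hg hg' => rw [RKHS.coe_add]; exact hg.add hg'
    | smul c g _ hg => rw [RKHS.coe_smul]; exact hg.const_smul c
  have hh : h ∈ closure (Submodule.span ℝ {RKHS.kerFun H x v | (x) (v)} : Set H) := by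
    rw [← Submodule.topologicalClosure_coe, RKHS.kerFun_dense]
    trivial
  obtain ⟨w, hw, hwh⟩ := mem_closure_iff_seq_limit.1 hh
  refine measurable_of_tendsto_metrizable (fun n => hspan (w n) (hw n)) ?_
  exact tendsto_pi_nhds.2 fun x => ((RKHS.continuous_eval x).tendsto h).comp hwh

theorem rkhs_abs_apply_le {X : Type} {H : Type} [NormedAddCommGroup H]
    [InnerProductSpace ℝ H] [CompleteSpace H] [RKHS ℝ H X ℝ] (h : H) (x : X) :
    |h x| ≤ ‖h‖ * (1 + RKHS.kernel H x x 1) := by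
  have h1 : ‖RKHS.kerFun H x (1 : ℝ)‖ ^ 2 = RKHS.kernel H x x 1 := by
    rw [← real_inner_self_eq_norm_sq, rkhs_inner_kerFun_kerFun]
  rw [← rkhs_inner_kerFun, ← h1, mul_comm]
  refine (abs_real_inner_le_norm _ _).trans ?_
  gcongr
  nlinarith [sq_nonneg (‖RKHS.kerFun H x (1 : ℝ)‖ - 1), norm_nonneg (RKHS.kerFun H x (1 : ℝ))]

/-- If every `K(·, y)` has integral one, then the constant function one represents integration. -/
theorem rkhsUnitBall_sq_sub_integral_le {X : Type} [MeasurableSpace X] {μ : Measure X}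
    [IsProbabilityMeasure μ] {K : X → X → ℝ} (hmeas : ∀ y, Measurable fun x => K x y)
    (hint : Integrable (fun x => K x x) μ) (hone : ∀ y, ∫ x, K x y ∂μ = 1) {f : X → ℝ}
    (hf : f ∈ rkhsUnitBall K) (b : X) : (f b - ∫ x, f x ∂μ) ^ 2 ≤ K b b - 1 := by
  obtain ⟨H, _, _, _, _, hH, h, hh, rfl⟩ := hf
  have hm : ∀ g : H, Measurable g := rkhs_measurable (by simpa only [hH] using hmeas)
  have hb : ∀ (g : H) (x : X), ‖g x‖ ≤ ‖g‖ * (1 + K x x) := fun g x => by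
    have := rkhs_abs_apply_le g x
    rwa [hH] at this
  have hbi : ∀ g : H, Integrable (fun x => ‖g‖ * (1 + K x x)) μ := fun g =>
    ((integrable_const 1).add hint).const_mul _
  have hi : ∀ g : H, Integrable g μ := fun g =>
    (hbi g).mono' (hm g).aestronglyMeasurable (ae_of_all _ (hb g))
  let I : H →ₗ[ℝ] ℝ :=
    { toFun := fun g => ∫ x, g x ∂μ
      map_add' := fun g g' => by
        rw [RKHS.coe_add]
        exact integral_add (hi g) (hi g')
      map_smul' := fun c g => by
        rw [RKHS.coe_smul]
        exact integral_const_mul c _ }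
  let I' : H →L[ℝ] ℝ := I.mkContinuous (∫ x, (1 + K x x) ∂μ) fun g => by
    refine (norm_integral_le_of_norm_le (hbi g) (ae_of_all _ (hb g))).trans_eq ?_
    rw [integral_const_mul, mul_comm]
  let e := (InnerProductSpace.toDual ℝ H).symm I'
  have he : ∀ g : H, inner ℝ e g = ∫ x, g x ∂μ := fun g =>
    InnerProductSpace.toDual_symm_apply
  -- By the reproducing property, the representer `e` of integration is the constant function one;
  -- hence its norm is one.
  have hk : ∀ y, inner ℝ (RKHS.kerFun H y (1 : ℝ)) e = 1 := fun y => by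
    rw [real_inner_comm, he]
    simp only [RKHS.kerFun_apply, hH, hone]
  have hee : inner ℝ e e = 1 := by
    rw [he]
    simp only [← rkhs_inner_kerFun, hk]
    simp
  have hd : inner ℝ (RKHS.kerFun H b (1 : ℝ) - e) h = h b - ∫ x, h x ∂μ := by
    rw [inner_sub_left, rkhs_inner_kerFun, he]
  have hn : ‖RKHS.kerFun H b (1 : ℝ) - e‖ ^ 2 = K b b - 1 := by
    rw [← real_inner_self_eq_norm_sq, inner_sub_left, inner_sub_right, inner_sub_right, hee, hk,
      rkhs_inner_kerFun_kerFun, hH, real_inner_comm, hk]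
    ring
  rw [← hd, ← hn, ← sq_abs]
  gcongr
  exact (abs_real_inner_le_norm _ _).trans (mul_le_of_le_one_right (norm_nonneg _) hh)

variable {D : Set ℝ} {ρ : Measure D} [IsProbabilityMeasure ρ]

theorem integral_infinitePi_finset_prod (u : Finset ℕ+) {F : ℕ+ → D → ℝ}
    (hF : ∀ j, Integrable (F j) ρ) :
    Integrable (fun x : ℕ+ → D => ∏ j ∈ u, F j (x j)) (Measure.infinitePi fun _ => ρ) ∧
    ∫ x, ∏ j ∈ u, F j (x j) ∂(Measure.infinitePi fun _ : ℕ+ => ρ) = ∏ j ∈ u, ∫ x, F j x ∂ρ := by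
  have h1 : ∀ x : ℕ+ → D, ∏ j ∈ u, F j (x j) = ∏ j : u, F j (u.restrict x j) := fun x =>
    (Finset.prod_coe_sort u fun j => F j (x j)).symm
  have h2 : Integrable (fun y : u → D => ∏ j : u, F j (y j)) (Measure.pi fun _ : u => ρ) :=
    Integrable.fintype_prod (f := fun j : u => F j) fun j => hF j
  simp only [h1]
  constructor
  · have := Measure.infinitePi_map_restrict (fun _ : ℕ+ => ρ) (I := u)
    rw [← this] at h2
    exact h2.comp_measurable (Finset.measurable_restrict u)
  · rw [integral_restrict_infinitePi (fun _ : ℕ+ => ρ) h2.aestronglyMeasurable,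
      integral_fintype_prod_eq_prod (fun j : u => F j)]
    exact Finset.prod_coe_sort u fun j => ∫ x, F j x ∂ρ

variable {k : D → D → ℝ} {γ : Finset ℕ+ → ℝ}

theorem integrable_kernel_left (hk_meas : Measurable (Function.uncurry k))
    (hk : (Matrix.of k).PosSemidef) (hk_int : Integrable (fun x => k x x) ρ) (y : D) :
    Integrable (fun x => k x y) ρ := by
  refine Integrable.mono' ((hk_int.add (integrable_const (k y y))).div_const 2)
    (hk_meas.comp (measurable_id.prodMk measurable_const)).aestronglyMeasurable
    (ae_of_all _ fun x => ?_)
  exact posSemidef_abs_le hk x y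

theorem integral_prodKernel_left (hk_meas : Measurable (Function.uncurry k))
    (hk : (Matrix.of k).PosSemidef) (hk_int : Integrable (fun x => k x x) ρ)
    (hk_anova : ∀ y, ∫ x, k x y ∂ρ = 0) {u : Finset ℕ+} (hu : u.Nonempty) (b : ℕ+ → D) :
    Integrable (fun x => prodKernel k u x b) (Measure.infinitePi fun _ => ρ) ∧
    ∫ x, prodKernel k u x b ∂(Measure.infinitePi fun _ : ℕ+ => ρ) = 0 := by
  obtain ⟨h1, h2⟩ := integral_infinitePi_finset_prod u (F := fun j x => k x (b j))
    fun j => integrable_kernel_left hk_meas hk hk_int (b j)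
  refine ⟨h1, h2.trans ?_⟩
  obtain ⟨j, hj⟩ := hu
  exact Finset.prod_eq_zero hj (hk_anova (b j))

/-- By monotone convergence, the diagonal series has integral `∑ γ_u M^|u| < ∞`, so it is finite
almost everywhere. -/
theorem ae_mem_infDomain (hk : (Matrix.of k).PosSemidef)
    (hk_int : Integrable (fun x => k x x) ρ) (hγ : ∀ u, 0 ≤ γ u)
    (hγ_sum : Summable fun u : Finset ℕ+ => γ u * (∫ x, k x x ∂ρ) ^ u.card) :
    ∀ᵐ x ∂(Measure.infinitePi fun _ : ℕ+ => ρ), x ∈ infDomain k γ := by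
  have h := fun u : Finset ℕ+ => integral_infinitePi_finset_prod u (F := fun _ x => k x x)
    fun _ => hk_int
  have hi : ∀ u, Integrable (fun x : ℕ+ → D => γ u * prodKernel k u x x)
      (Measure.infinitePi fun _ : ℕ+ => ρ) := fun u => (h u).1.const_mul (γ u)
  have hn : ∀ u (x : ℕ+ → D), 0 ≤ γ u * prodKernel k u x x := fun u x =>
    mul_nonneg (hγ u) (posSemidef_diag_nonneg (posSemidef_prodKernel hk u) x)
  have hl : ∀ u : Finset ℕ+, ∫⁻ x, ENNReal.ofReal (γ u * prodKernel k u x x)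
      ∂(Measure.infinitePi fun _ : ℕ+ => ρ) =
      ENNReal.ofReal (γ u * (∫ x, k x x ∂ρ) ^ u.card) := fun u => by
    rw [← ofReal_integral_eq_lintegral_ofReal (hi u) (ae_of_all _ (hn u)), integral_const_mul]
    congr 2
    refine (h u).2.trans ?_
    simp
  have hm : ∀ u : Finset ℕ+, AEMeasurable (fun x : ℕ+ → D =>
      ENNReal.ofReal (γ u * prodKernel k u x x)) (Measure.infinitePi fun _ : ℕ+ => ρ) :=
    fun u => (hi u).aemeasurable.ennreal_ofReal
  have ht := lintegral_tsum hm
  simp only [hl] at ht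
  have hfin := ae_lt_top' (AEMeasurable.tsum hm) (ht.trans_ne hγ_sum.tsum_ofReal_ne_top)
  filter_upwards [hfin] with x hx
  refine (ENNReal.summable_toReal hx.ne).congr fun u => ?_
  exact ENNReal.toReal_ofReal (hn u x)

theorem infIntegral_indicator_infDomain (hk : (Matrix.of k).PosSemidef)
    (hk_int : Integrable (fun x => k x x) ρ) (hγ : ∀ u, 0 ≤ γ u)
    (hγ_sum : Summable fun u : Finset ℕ+ => γ u * (∫ x, k x x ∂ρ) ^ u.card)
    (f : (ℕ+ → D) → ℝ) :
    infIntegral ρ ((infDomain k γ).indicator f) = infIntegral ρ f := by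
  refine integral_congr_ae ?_
  filter_upwards [ae_mem_infDomain hk hk_int hγ hγ_sum] with x hx
  exact Set.indicator_of_mem hx f

theorem infIntegral_foolingFunction (hk_meas : Measurable (Function.uncurry k))
    (hk : (Matrix.of k).PosSemidef) (hk_int : Integrable (fun x => k x x) ρ)
    (hk_anova : ∀ y, ∫ x, k x y ∂ρ = 0) {U : Finset (Finset ℕ+)} (hU : ∅ ∉ U) (b : ℕ+ → D)
    (l : ℝ) :
    infIntegral ρ (fun x => l * foolingFunction k γ U b x) =
      l * ∑ u ∈ U, γ u * prodKernel k u b b := by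
  have h : ∀ u ∈ U, Integrable (fun x => prodKernel k u x b) (Measure.infinitePi fun _ => ρ) ∧
      ∫ x, prodKernel k u x b ∂(Measure.infinitePi fun _ : ℕ+ => ρ) = 0 := fun u hu =>
    integral_prodKernel_left hk_meas hk hk_int hk_anova
      (Finset.nonempty_iff_ne_empty.2 fun he => hU (he ▸ hu)) b
  unfold infIntegral foolingFunction
  rw [integral_const_mul, integral_sub (integrable_const _)
    (integrable_finsetSum _ fun u hu => (h u hu).1.const_mul _),
    integral_finsetSum _ fun u hu => (h u hu).1.const_mul _]
  rw [Finset.sum_eq_zero (s := U) (f := fun u => ∫ x, γ u * prodKernel k u x b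
    ∂(Measure.infinitePi fun _ : ℕ+ => ρ)) fun u hu => by
      rw [integral_const_mul, (h u hu).2, mul_zero]]
  simp

theorem univariate_sq_sub_integral_le (hk_meas : Measurable (Function.uncurry k))
    (hk : (Matrix.of k).PosSemidef) (hk_int : Integrable (fun x => k x x) ρ)
    (hk_anova : ∀ y, ∫ x, k x y ∂ρ = 0) (hγ_empty : γ ∅ = 1) {f : (ℕ+ → D) → ℝ}
    (hf : f ∈ rkhsUnitBall (weightedKernel k γ {1})) (b : ℕ+ → D) :
    (infIntegral ρ f - f b) ^ 2 ≤ γ {1} * k (b 1) (b 1) := by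
  have hw : ∀ x y : ℕ+ → D, weightedKernel k γ {1} x y = 1 + γ {1} * k (x 1) (y 1) := by
    intro x y
    rw [weightedKernel, show ({1} : Finset ℕ+).powerset = {∅, {1}} from rfl, Finset.sum_pair (by simp), hγ_empty]
    simp
  have hone : ∀ y : ℕ+ → D, Integrable (fun x : ℕ+ → D => k (x 1) (y 1))
      (Measure.infinitePi fun _ => ρ) ∧
      ∫ x : ℕ+ → D, k (x 1) (y 1) ∂(Measure.infinitePi fun _ : ℕ+ => ρ) = 0 := fun y => by
    simpa using integral_prodKernel_left hk_meas hk hk_int hk_anova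
      (Finset.singleton_nonempty (1 : ℕ+)) y
  have hd : Integrable (fun x : ℕ+ → D => k (x 1) (x 1)) (Measure.infinitePi fun _ => ρ) := by
    simpa using (integral_infinitePi_finset_prod {1} (F := fun _ x => k x x) fun _ => hk_int).1
  have := rkhsUnitBall_sq_sub_integral_le (μ := Measure.infinitePi fun _ : ℕ+ => ρ)
    (K := weightedKernel k γ {1}) (fun y => ?_) ?_ (fun y => ?_) hf b
  · rw [hw] at this
    unfold infIntegral
    linarith [sub_sq_comm (f b) (∫ x, f x ∂(Measure.infinitePi fun _ : ℕ+ => ρ))]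
  · simp only [hw]
    have hp : Measurable fun x : ℕ+ → D => (x 1, y 1) :=
      (measurable_pi_apply 1).prodMk measurable_const
    exact ((hk_meas.comp hp).const_mul _).const_add 1
  · simp only [hw]
    exact (integrable_const _).add (hd.const_mul _)
  · simp only [hw]
    rw [integral_add (integrable_const _) ((hone y).1.const_mul _), integral_const_mul, (hone y).2]
    simp

end Integration

/-! ### Comparison of algorithms on different inputs -/

namespace DetAlgorithm

variable {X : Type} {A : DetAlgorithm X} {f g : X → ℝ}

/-- Adaptive decisions depend only on the values seen so far: two inputs that agree at the points
queried for one of them produce the same run. -/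
theorem answers_congr {n : ℕ}
    (h : ∀ i < n, f (A.query (A.answers f i)) = g (A.query (A.answers f i))) :
    ∀ i ≤ n, A.answers g i = A.answers f i := by
  intro i
  induction i with
  | zero => intro _; rfl
  | succ i ih =>
    intro hi
    rw [answers, answers, ih (by omega), h i (by omega)]

theorem finished_numEvals (hf : A.Halts f) : A.finished (A.answers f (A.numEvals f)) :=
  Nat.sInf_mem (s := {n | A.finished (A.answers f n)}) hf

theorem halts_congr (hf : A.Halts f)
    (h : ∀ i < A.numEvals f, f (A.query (A.answers f i)) = g (A.query (A.answers f i))) :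
    A.Halts g :=
  ⟨A.numEvals f, by rw [answers_congr h _ le_rfl]; exact finished_numEvals hf⟩

theorem numEvals_congr (hf : A.Halts f)
    (h : ∀ i < A.numEvals f, f (A.query (A.answers f i)) = g (A.query (A.answers f i))) :
    A.numEvals g = A.numEvals f := by
  apply le_antisymm
  · refine Nat.sInf_le ?_
    rw [Set.mem_ofPred_eq, answers_congr h _ le_rfl]
    exact finished_numEvals hf
  · by_contra! hlt
    have h1 := finished_numEvals (halts_congr hf h)
    rw [answers_congr h _ hlt.le] at h1
    exact hlt.not_ge (Nat.sInf_le h1)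

theorem value_congr (hf : A.Halts f)
    (h : ∀ i < A.numEvals f, f (A.query (A.answers f i)) = g (A.query (A.answers f i))) :
    A.value g = A.value f := by
  rw [value, numEvals_congr hf h, answers_congr h _ le_rfl, value]

theorem cost_query_le {c : X → ℝ≥0∞} {i : ℕ} (hi : i < A.numEvals f) :
    c (A.query (A.answers f i)) ≤ A.cost c f :=
  Finset.single_le_sum (f := fun i => c (A.query (A.answers f i))) (fun _ _ => zero_le)
    (Finset.mem_range.2 hi)

theorem mul_numEvals_le_cost {c : X → ℝ≥0∞} {q : ℝ≥0∞} (hq : ∀ x, q ≤ c x) :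
    q * A.numEvals f ≤ A.cost c f := by
  rw [cost, mul_comm, ← nsmul_eq_mul]
  refine le_trans (le_of_eq ?_) (Finset.sum_le_sum fun i _ => hq _)
  simp

theorem cost_one : A.cost (fun _ => 1) f = A.numEvals f := by
  simp [cost]

end DetAlgorithm

/-! ### Lower bounds for the error of a given randomized algorithm -/

namespace RandAlgorithm

variable {X : Type} {F : Set (X → ℝ)} {C : Set (X → ℝ≥0∞)}

/-- The infimum over the cost functions need not be attained, hence the budget `N + 1`. -/
theorem exists_cost_of_worstCost_le {Q : RandAlgorithm F C} {N : ℝ} (hN : 0 ≤ N)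
    (hQ : Q.worstCost ≤ ENNReal.ofReal N) :
    ∃ c ∈ C, ∀ f ∈ F, ∫⁻ ω, (Q.alg ω).cost c f ∂Q.P ≤ ENNReal.ofReal (N + 1) := by
  have h : Q.worstCost < ENNReal.ofReal (N + 1) :=
    hQ.trans_lt ((ENNReal.ofReal_lt_ofReal_iff (by linarith)).2 (by linarith))
  obtain ⟨c, hc⟩ := iInf_lt_iff.1 h
  obtain ⟨hcC, hc⟩ := iInf_lt_iff.1 hc
  exact ⟨c, hcC, fun f hf => (le_iSup₂_of_le f hf le_rfl).trans hc.le⟩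

theorem error_sq (Q : RandAlgorithm F C) (I : (X → ℝ) → ℝ) :
    Q.error I ^ 2 = ⨆ f ∈ F, ∫⁻ ω, ENNReal.ofReal ((I f - (Q.alg ω).value f) ^ 2) ∂Q.P := by
  rw [error, ← ENNReal.rpow_natCast, ← ENNReal.rpow_mul]
  norm_num

theorem error_mono_of_forall {F' : Set (X → ℝ)} {C' : Set (X → ℝ≥0∞)} {Q : RandAlgorithm F C}
    {Q' : RandAlgorithm F' C'} {I : (X → ℝ) → ℝ}
    (h : ∀ g ∈ F', ∃ f ∈ F, ∫⁻ ω, ENNReal.ofReal ((I g - (Q'.alg ω).value g) ^ 2) ∂Q'.P ≤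
      ∫⁻ ω, ENNReal.ofReal ((I f - (Q.alg ω).value f) ^ 2) ∂Q.P) :
    Q'.error I ≤ Q.error I := by
  refine ENNReal.rpow_le_rpow (iSup₂_le fun g hg => ?_) (by norm_num)
  obtain ⟨f, hf, hfg⟩ := h g hg
  exact hfg.trans (le_iSup₂_of_le f hf le_rfl)

/-- An algorithm for `F` that uses points from `S` only, at a cost of at least `q` per evaluation,
can be used for all functions whose truncation to `S` belongs to `F`. -/
theorem minError_one_le_error (Q : RandAlgorithm F C) {c : X → ℝ≥0∞} (hc : c ∈ C)
    {I : (X → ℝ) → ℝ} {S : Set X} {F' : Set (X → ℝ)} (hF' : ∀ g ∈ F', S.indicator g ∈ F)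
    (hI : ∀ g ∈ F', I (S.indicator g) = I g) (hcS : ∀ x, c x < ⊤ → x ∈ S) {q N : ℝ} (hq : 0 < q)
    (hqc : ∀ x, ENNReal.ofReal q ≤ c x)
    (hN : ∀ f ∈ F, ∫⁻ ω, (Q.alg ω).cost c f ∂Q.P ≤ ENNReal.ofReal N) :
    minError F' {fun _ => 1} I (N / q) ≤ Q.error I := by
  -- Finite expected cost keeps all queries in `S` almost surely, so the run does not distinguish
  -- `g` from its truncation.
  have key : ∀ g ∈ F', ∀ᵐ ω ∂Q.P, (Q.alg ω).Halts (S.indicator g) ∧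
      ∀ i < (Q.alg ω).numEvals (S.indicator g),
        S.indicator g ((Q.alg ω).query ((Q.alg ω).answers (S.indicator g) i)) =
          g ((Q.alg ω).query ((Q.alg ω).answers (S.indicator g) i)) := by
    intro g hg
    have hfin := ae_lt_top' (Q.aemeasurable_cost c hc _ (hF' g hg))
      ((hN _ (hF' g hg)).trans_lt ENNReal.ofReal_lt_top).ne
    filter_upwards [hfin, Q.halts _ (hF' g hg)] with ω h1 h2
    exact ⟨h2, fun i hi => Set.indicator_of_mem
      (hcS _ ((DetAlgorithm.cost_query_le hi).trans_lt h1)) g⟩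
  have hval : ∀ g ∈ F', (fun ω => (Q.alg ω).value (S.indicator g)) =ᵐ[Q.P]
      fun ω => (Q.alg ω).value g := fun g hg => by
    filter_upwards [key g hg] with ω h
    exact (DetAlgorithm.value_congr h.1 h.2).symm
  have hnum : ∀ g ∈ F', (fun ω => (Q.alg ω).numEvals (S.indicator g)) =ᵐ[Q.P]
      fun ω => (Q.alg ω).numEvals g := fun g hg => by
    filter_upwards [key g hg] with ω h
    exact (DetAlgorithm.numEvals_congr h.1 h.2).symm
  have hmnum : ∀ g ∈ F', AEMeasurable (fun ω => (Q.alg ω).numEvals g) Q.P := fun g hg =>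
    (Q.aemeasurable_numEvals _ (hF' g hg)).congr (hnum g hg)
  let Q' : RandAlgorithm F' {fun _ : X => (1 : ℝ≥0∞)} :=
    { Ω := Q.Ω
      measurableSpace := Q.measurableSpace
      P := Q.P
      isProbabilityMeasure := Q.isProbabilityMeasure
      alg := Q.alg
      halts := fun g hg => (key g hg).mono fun ω h => DetAlgorithm.halts_congr h.1 h.2
      aemeasurable_value := fun g hg => (Q.aemeasurable_value _ (hF' g hg)).congr (hval g hg)
      aemeasurable_numEvals := hmnum
      aemeasurable_cost := by
        rintro _ rfl g hg
        simp only [DetAlgorithm.cost_one]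
        exact (measurable_from_top (f := fun n : ℕ => (n : ℝ≥0∞))).comp_aemeasurable (hmnum g hg) }
  have hcost : Q'.worstCost ≤ ENNReal.ofReal (N / q) := by
    refine iInf₂_le_of_le (fun _ => 1) rfl (iSup₂_le fun g hg => ?_)
    change ∫⁻ ω, (Q.alg ω).cost (fun _ => 1) g ∂Q.P ≤ _
    simp only [DetAlgorithm.cost_one]
    rw [ENNReal.ofReal_div_of_pos hq, ENNReal.le_div_iff_mul_le
      (Or.inl (ENNReal.ofReal_pos.2 hq).ne') (Or.inl ENNReal.ofReal_ne_top), mul_comm,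
      ← lintegral_const_mul' _ _ ENNReal.ofReal_ne_top]
    refine le_trans (lintegral_mono_ae ?_) (hN _ (hF' g hg))
    filter_upwards [hnum g hg] with ω h
    rw [← h]
    exact DetAlgorithm.mul_numEvals_le_cost hqc
  refine (iInf₂_le Q' hcost).trans (error_mono_of_forall fun g hg => ⟨_, hF' g hg, le_of_eq ?_⟩)
  refine lintegral_congr_ae ?_
  filter_upwards [hval g hg] with ω h
  rw [hI g hg, h]

/-- Functions that vanish at all cheap points cannot be integrated well. -/
theorem le_error_sq_of_vanishing (Q : RandAlgorithm F C) {c : X → ℝ≥0∞} (hc : c ∈ C)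
    {I : (X → ℝ) → ℝ} {f : X → ℝ} (hf : f ∈ F) (hnf : -f ∈ F) (hI : I (-f) = -I f) {N : ℝ}
    (hN : 0 < N) (hfc : ∀ x, c x < ENNReal.ofReal (4 * N) → f x = 0)
    (hcost : ∫⁻ ω, (Q.alg ω).cost c f ∂Q.P ≤ ENNReal.ofReal N) :
    ENNReal.ofReal (3 / 4 * I f ^ 2) ≤ Q.error I ^ 2 := by
  have hT : ENNReal.ofReal (4 * N) ≠ 0 := (ENNReal.ofReal_pos.2 (by linarith)).ne'
  set e := Q.error I ^ 2 with he
  rw [error_sq] at he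
  have h1 : ∫⁻ ω, ENNReal.ofReal ((I f - (Q.alg ω).value f) ^ 2) ∂Q.P ≤ e :=
    he ▸ le_iSup₂_of_le (f := fun f _ =>
      ∫⁻ ω, ENNReal.ofReal ((I f - (Q.alg ω).value f) ^ 2) ∂Q.P) f hf le_rfl
  have h2 : ∫⁻ ω, ENNReal.ofReal ((I (-f) - (Q.alg ω).value (-f)) ^ 2) ∂Q.P ≤ e :=
    he ▸ le_iSup₂_of_le (f := fun f _ =>
      ∫⁻ ω, ENNReal.ofReal ((I f - (Q.alg ω).value f) ^ 2) ∂Q.P) (-f) hnf le_rfl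
  have hm : ∀ g ∈ F, AEMeasurable
      (fun ω => ENNReal.ofReal ((I g - (Q.alg ω).value g) ^ 2)) Q.P := fun g hg =>
    (((Q.aemeasurable_value g hg).const_sub _).pow_const 2).ennreal_ofReal
  -- If the cost is below `4 * N`, then `f` and `-f` receive the same output, and the two squared
  -- errors sum to at least `2 * I f ^ 2`. Otherwise the last term alone suffices, as in Markov's
  -- inequality.
  have hpt : ∀ᵐ ω ∂Q.P, ENNReal.ofReal (2 * I f ^ 2) ≤
      ENNReal.ofReal ((I f - (Q.alg ω).value f) ^ 2) +
      ENNReal.ofReal ((I (-f) - (Q.alg ω).value (-f)) ^ 2) +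
      ENNReal.ofReal (2 * I f ^ 2) / ENNReal.ofReal (4 * N) * (Q.alg ω).cost c f := by
    filter_upwards [Q.halts f hf] with ω hω
    by_cases hlt : (Q.alg ω).cost c f < ENNReal.ofReal (4 * N)
    · have hv : (Q.alg ω).value (-f) = (Q.alg ω).value f :=
        DetAlgorithm.value_congr hω fun i hi => by
          rw [Pi.neg_apply, hfc _ ((DetAlgorithm.cost_query_le hi).trans_lt hlt), neg_zero]
      refine le_add_right ?_
      rw [hv, hI, ← ENNReal.ofReal_add (sq_nonneg _) (sq_nonneg _)]
      exact ENNReal.ofReal_le_ofReal (by nlinarith [sq_nonneg ((Q.alg ω).value f)])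
    · refine le_add_left ?_
      calc ENNReal.ofReal (2 * I f ^ 2)
          = ENNReal.ofReal (2 * I f ^ 2) / ENNReal.ofReal (4 * N) * ENNReal.ofReal (4 * N) :=
            (ENNReal.div_mul_cancel hT ENNReal.ofReal_ne_top).symm
        _ ≤ _ := by gcongr; exact not_lt.1 hlt
  have hadd : AEMeasurable (fun ω => ENNReal.ofReal ((I f - (Q.alg ω).value f) ^ 2) +
      ENNReal.ofReal ((I (-f) - (Q.alg ω).value (-f)) ^ 2)) Q.P := (hm f hf).add (hm _ hnf)
  have h3 := lintegral_mono_ae hpt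
  rw [lintegral_const, measure_univ, mul_one, lintegral_add_left' hadd,
    lintegral_add_left' (hm f hf), lintegral_const_mul'' _ (Q.aemeasurable_cost c hc f hf)] at h3
  -- The expected cost is at most a quarter of the threshold, so a loss of `I f ^ 2 / 2` remains;
  -- this yields the factor `3 / 4`.
  have h4 : ENNReal.ofReal (2 * I f ^ 2) ≤ e + e + ENNReal.ofReal (1 / 2 * I f ^ 2) := by
    refine h3.trans (add_le_add (add_le_add h1 h2) ?_)
    refine (mul_le_mul_right hcost _).trans (le_of_eq ?_)
    rw [← ENNReal.ofReal_div_of_pos (by linarith), ← ENNReal.ofReal_mul (by positivity)]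
    congr 1
    field_simp
    ring
  by_cases htop : e = ⊤
  · rw [htop]; exact le_top
  · clear_value e
    lift e to ℝ≥0 using htop
    rw [← ENNReal.ofReal_coe_nnreal, ← ENNReal.ofReal_add (by positivity) (by positivity),
      ← ENNReal.ofReal_add (by positivity) (by positivity),
      ENNReal.ofReal_le_ofReal_iff (by positivity)] at h4
    rw [← ENNReal.ofReal_coe_nnreal, ENNReal.ofReal_le_ofReal_iff (by positivity)]
    linarith

end RandAlgorithm

/-! ### Minimal errors -/

theorem minError_anti {X : Type} {F : Set (X → ℝ)} {C : Set (X → ℝ≥0∞)} {I : (X → ℝ) → ℝ}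
    {M N : ℝ} (h : M ≤ N) : minError F C I N ≤ minError F C I M :=
  le_iInf₂ fun Q hQ => iInf₂_le Q (hQ.trans (ENNReal.ofReal_le_ofReal h))

theorem le_minError_sq {X : Type} {F : Set (X → ℝ)} {C : Set (X → ℝ≥0∞)} {I : (X → ℝ) → ℝ}
    {N : ℝ} {z : ℝ≥0∞}
    (h : ∀ Q : RandAlgorithm F C, Q.worstCost ≤ ENNReal.ofReal N → z ≤ Q.error I ^ 2) :
    z ≤ minError F C I N ^ 2 := by
  have h2 : ∀ w : ℝ≥0∞, w ^ (2 : ℕ) = w ^ (2 : ℝ) := fun w => by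
    rw [← ENNReal.rpow_natCast]; norm_num
  rw [h2, ← ENNReal.rpow_inv_le_iff two_pos]
  refine le_iInf₂ fun Q hQ => ?_
  rw [ENNReal.rpow_inv_le_iff two_pos, ← h2]
  exact h Q hQ

/-- Evaluating the integrand at a single point. -/
theorem minError_one_sq_le {X : Type} {F : Set (X → ℝ)} {I : (X → ℝ) → ℝ} (b : X) {z : ℝ}
    (h : ∀ f ∈ F, (I f - f b) ^ 2 ≤ z) :
    minError F {fun _ => 1} I 1 ^ 2 ≤ ENNReal.ofReal z := by
  let A : DetAlgorithm X := ⟨fun _ => b, fun l => l ≠ [], fun l => l.sum⟩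
  have hn : ∀ f, A.numEvals f = 1 := fun f => by
    have h1 : A.finished (A.answers f 1) := by simp [A, DetAlgorithm.answers]
    have h0 : ¬ A.finished (A.answers f 0) := by simp [A, DetAlgorithm.answers]
    refine le_antisymm (Nat.sInf_le h1) (Nat.one_le_iff_ne_zero.2 fun he => h0 ?_)
    rw [← he]
    exact DetAlgorithm.finished_numEvals ⟨1, h1⟩
  have hv : ∀ f, A.value f = f b := fun f => by
    simp [DetAlgorithm.value, hn, DetAlgorithm.answers, A]
  let Q : RandAlgorithm F {fun _ : X => (1 : ℝ≥0∞)} :=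
    { Ω := Unit
      P := Measure.dirac ()
      alg := fun _ => A
      halts := fun f _ => ae_of_all _ fun _ => ⟨1, by simp [A, DetAlgorithm.answers]⟩
      aemeasurable_value := fun _ _ => aemeasurable_const
      aemeasurable_numEvals := fun _ _ => aemeasurable_const
      aemeasurable_cost := fun _ _ _ _ => aemeasurable_const }
  have hQ : Q.worstCost ≤ ENNReal.ofReal 1 := by
    refine iInf₂_le_of_le (fun _ => 1) rfl (iSup₂_le fun f _ => ?_)
    simp [Q, DetAlgorithm.cost_one, hn]
  refine (pow_le_pow_left' (iInf₂_le Q hQ) 2).trans ?_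
  rw [RandAlgorithm.error_sq]
  refine iSup₂_le fun f hf => ?_
  simp only [Q, hv, lintegral_const, measure_univ, mul_one]
  exact ENNReal.ofReal_le_ofReal (h f hf)

/-! ### Summable antitone sequences -/

/-- For `j ≥ 2 * n` the block `(n, j]` has at least `j / 2` terms, each at least `f j`, and its sum
is small by the Cauchy criterion. -/
theorem tendsto_mul_natCast_of_antitone_summable {f : ℕ+ → ℝ} (hf : Antitone f)
    (h0 : ∀ j, 0 ≤ f j) (hs : Summable f) :
    Tendsto (fun j : ℕ+ => f j * ((j : ℕ) : ℝ)) atTop (𝓝 0) := by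
  rw [Metric.tendsto_nhds]
  intro ε hε
  obtain ⟨s, hs⟩ := summable_iff_vanishing_norm.1 hs (ε / 2) (by positivity)
  obtain ⟨n, hn⟩ := s.exists_le
  filter_upwards [eventually_ge_atTop (2 * n)] with j hj
  have hd : Disjoint (Finset.Ioc n j) s := Finset.disjoint_left.2 fun i hi his =>
    (Finset.mem_Ioc.1 hi).1.not_ge (hn i his)
  have h1 := hs _ hd
  rw [Real.norm_eq_abs, abs_of_nonneg (Finset.sum_nonneg fun i _ => h0 i)] at h1
  have h2 := Finset.card_nsmul_le_sum (Finset.Ioc n j) f (f j)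
    fun i hi => hf (Finset.mem_Ioc.1 hi).2
  rw [PNat.card_Ioc, nsmul_eq_mul] at h2
  have hj' : 2 * (n : ℕ) ≤ j := by exact_mod_cast hj
  have h3 : ((j : ℕ) : ℝ) / 2 ≤ (((j : ℕ) - n : ℕ) : ℝ) := by
    rw [Nat.cast_sub (by omega)]
    have : (2 : ℝ) * ((n : ℕ) : ℝ) ≤ ((j : ℕ) : ℝ) := by exact_mod_cast hj'
    linarith
  rw [dist_zero_right, Real.norm_eq_abs, abs_of_nonneg (mul_nonneg (h0 j) (by positivity))]
  nlinarith [mul_le_mul_of_nonneg_right h3 (h0 j)]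

theorem tendsto_mul_rpow_of_antitone_summable {f : ℕ+ → ℝ} (hf : Antitone f)
    (h0 : ∀ j, 0 ≤ f j) {q : ℝ} (hq : 0 < q) (hs : Summable fun j => f j ^ q⁻¹) :
    Tendsto (fun j : ℕ+ => f j * ((j : ℕ) : ℝ) ^ q) atTop (𝓝 0) := by
  have h := tendsto_mul_natCast_of_antitone_summable
    (fun i j hij => Real.rpow_le_rpow (h0 j) (hf hij) (inv_nonneg.2 hq.le))
    (fun j => Real.rpow_nonneg (h0 j) _) hs
  have h' := h.rpow_const (p := q) (Or.inr hq.le)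
  rw [Real.zero_rpow hq.ne'] at h'
  refine h'.congr fun j => ?_
  rw [Real.mul_rpow (Real.rpow_nonneg (h0 j) _) (Nat.cast_nonneg _), ← Real.rpow_mul (h0 j),
    inv_mul_cancel₀ hq.ne', Real.rpow_one]

/-! ### Decay of the weights -/

section Weights

variable {D : Set ℝ} {k : D → D → ℝ} {γ : Finset ℕ+ → ℝ}

theorem anchoredWeight_nonneg (hk_pos : ∀ a, 0 < k a a) (hγ : ∀ u, 0 ≤ γ u) (a : ℕ+ → D)
    (u : Finset ℕ+) : 0 ≤ anchoredWeight k γ a u :=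
  mul_nonneg (hγ u) (prodKernel_self_pos hk_pos u a).le

theorem exists_listing_not_tendsto {a : ℕ+ → D} {p : ℝ} (hp : decay k γ a < (p : EReal)) :
    ∃ e, IsDecreasingListing k γ a e ∧
      ¬ Tendsto (fun j : ℕ+ => anchoredWeight k γ a (e j) * ((j : ℕ) : ℝ) ^ p) atTop (𝓝 0) := by
  by_contra! h
  exact hp.not_ge (le_sSup ⟨p, rfl, h⟩)

/-- Since `a` lies in `𝔛`, the anchored weights are summable; being antitone along a listing, they
are `o(1 / j)`. -/
theorem one_lt_of_decay_lt (hk_pos : ∀ a, 0 < k a a) (hγ : ∀ u, 0 ≤ γ u) {a : ℕ+ → D}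
    (ha : a ∈ infDomain k γ) {p : ℝ} (hp : decay k γ a < (p : EReal)) : 1 < p := by
  by_contra! hle
  obtain ⟨e, ⟨hinj, -, hanti⟩, hnot⟩ :=
    exists_listing_not_tendsto (hp.trans_le (EReal.coe_le_coe_iff.2 hle))
  refine hnot ?_
  simp only [Real.rpow_one]
  exact tendsto_mul_natCast_of_antitone_summable hanti
    (fun j => anchoredWeight_nonneg hk_pos hγ a _) (Summable.comp_injective ha hinj)

theorem exists_frequently_le_of_not_tendsto {f : ℕ+ → ℝ} (h0 : ∀ j, 0 ≤ f j) {p : ℝ}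
    (h : ¬ Tendsto (fun j : ℕ+ => f j * ((j : ℕ) : ℝ) ^ p) atTop (𝓝 0)) :
    ∃ δ > 0, ∃ᶠ j : ℕ+ in atTop, δ * ((j : ℕ) : ℝ) ^ (-p) ≤ f j := by
  rw [Metric.tendsto_nhds] at h
  push Not at h
  obtain ⟨δ, hδ, h⟩ := h
  refine ⟨δ, hδ, h.mono fun j hj => ?_⟩
  have hj0 : (0 : ℝ) < ((j : ℕ) : ℝ) ^ p := Real.rpow_pos_of_pos (by exact_mod_cast j.pos) p
  rw [dist_zero_right, Real.norm_eq_abs, abs_of_nonneg (mul_nonneg (h0 j) hj0.le)] at hj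
  rw [Real.rpow_neg (Nat.cast_nonneg _), ← div_eq_mul_inv, div_le_iff₀ hj0]
  exact hj

/-! ### Product weights -/

theorem productWeight_mul_prodKernel {g : ℕ+ → ℝ} (hg : ∀ u, γ u = ∏ j ∈ u, g j)
    (u : Finset ℕ+) (x : ℕ+ → D) :
    γ u * prodKernel k u x x = ∏ j ∈ u, g j * k (x j) (x j) := by
  rw [hg, prodKernel, ← Finset.prod_mul_distrib]

/-- The decay concerns all sets `u`, the conclusion only singletons. Choose `q` strictly between the
decay and `p`. If eventually `g j < j^(-p)`, then `∑ (g j * k a a)^(1/q)` converges, hence so does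
the sum of the corresponding products over all finite sets, and the listed weights would be
`o(j^(-q))`. -/
theorem exists_frequently_le_of_decay_lt_product (hk_pos : ∀ a, 0 < k a a) {g : ℕ+ → ℝ}
    (hg0 : ∀ j, 0 ≤ g j) (hg : ∀ u, γ u = ∏ j ∈ u, g j) {a : D}
    (ha : (fun _ => a) ∈ infDomain k γ) {p : ℝ} (hp : decay k γ (fun _ => a) < (p : EReal)) :
    ∃ᶠ j : ℕ+ in atTop, ((j : ℕ) : ℝ) ^ (-p) ≤ g j := by
  have hγ : ∀ u, 0 ≤ γ u := fun u => by
    rw [hg]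
    exact Finset.prod_nonneg fun j _ => hg0 j
  obtain ⟨q, hq, hqp⟩ := EReal.lt_iff_exists_real_btwn.1 hp
  have hqp : q < p := by exact_mod_cast hqp
  have hq1 : 1 < q := one_lt_of_decay_lt hk_pos hγ ha hq
  have hq0 : 0 < q := by linarith
  obtain ⟨e, ⟨hinj, -, hanti⟩, hnot⟩ := exists_listing_not_tendsto hq
  by_contra hcon
  rw [not_frequently] at hcon
  refine hnot (tendsto_mul_rpow_of_antitone_summable hanti
    (fun j => anchoredWeight_nonneg hk_pos hγ _ _) hq0 ?_)
  have hsum : Summable fun j : ℕ+ => (g j * k a a) ^ q⁻¹ := by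
    have hp' : Summable fun j : ℕ+ => k a a ^ q⁻¹ * ((j : ℕ) : ℝ) ^ (-p * q⁻¹) := by
      have hlt : -p * q⁻¹ < -1 := by
        rw [neg_mul, neg_lt_neg_iff, ← div_eq_mul_inv, one_lt_div hq0]
        exact hqp
      have hnat := (Real.summable_nat_rpow.2 hlt).comp_injective PNat.coe_injective
      exact hnat.mul_left _
    refine summable_of_isBigO hp' (Asymptotics.IsBigO.of_bound 1 ?_)
    have hcof : ∀ᶠ j : ℕ+ in cofinite, g j < ((j : ℕ) : ℝ) ^ (-p) := by
      obtain ⟨n, hn⟩ := eventually_atTop.1 hcon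
      refine (Set.finite_Iio n).subset fun j hj => ?_
      by_contra hjn
      exact hj (not_le.1 (hn j (not_lt.1 hjn)))
    filter_upwards [hcof] with j hj
    have hnn : 0 ≤ g j * k a a := mul_nonneg (hg0 j) (hk_pos a).le
    rw [one_mul, Real.norm_of_nonneg (Real.rpow_nonneg hnn _), Real.norm_of_nonneg
      (mul_nonneg (Real.rpow_nonneg (hk_pos a).le _) (Real.rpow_nonneg (Nat.cast_nonneg _) _)),
      Real.rpow_mul (Nat.cast_nonneg _), ← Real.mul_rpow (hk_pos a).le
        (Real.rpow_nonneg (Nat.cast_nonneg _) _)]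
    refine Real.rpow_le_rpow hnn ?_ (inv_nonneg.2 hq0.le)
    rw [mul_comm]
    exact mul_le_mul_of_nonneg_left hj.le (hk_pos a).le
  have hprod := (summable_finsetProd_of_summable_nonneg
    (fun j => Real.rpow_nonneg (mul_nonneg (hg0 j) (hk_pos a).le) _) hsum).comp_injective hinj
  refine hprod.congr fun j => ?_
  rw [Function.comp_apply, anchoredWeight, productWeight_mul_prodKernel hg,
    Real.finsetProd_rpow _ _ fun j _ => mul_nonneg (hg0 j) (hk_pos a).le]

theorem mem_infDomain_product_iff (hk_pos : ∀ a, 0 < k a a) {g : ℕ+ → ℝ} (hg0 : ∀ j, 0 ≤ g j)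
    (hg : ∀ u, γ u = ∏ j ∈ u, g j) (x : ℕ+ → D) :
    x ∈ infDomain k γ ↔ Summable fun j => g j * k (x j) (x j) := by
  constructor
  · intro h
    refine (Summable.comp_injective h (Finset.singleton_injective (α := ℕ+))).congr fun j => ?_
    simp [productWeight_mul_prodKernel hg]
  · intro h
    refine (summable_finsetProd_of_summable_nonneg
      (fun j => mul_nonneg (hg0 j) (hk_pos _).le) h).congr fun u => ?_
    rw [productWeight_mul_prodKernel hg]

/-! ### Finite-intersection weights -/

theorem encard_inter_le_of_finiteIntersection {r : ℕ}
    (hr : ∀ u, 0 < γ u → {v | 0 < γ v ∧ (u ∩ v).Nonempty}.encard ≤ 1 + (r : ℕ∞))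
    (v : Finset ℕ+) :
    {u | 0 < γ u ∧ ¬ Disjoint u v}.encard ≤ (((1 + r) * v.card : ℕ) : ℕ∞) := by
  induction v using Finset.induction_on with
  | empty => simp
  | insert j v hj ih =>
    -- All positively weighted sets containing `j` meet any fixed one of them.
    have h1 : {u | 0 < γ u ∧ j ∈ u}.encard ≤ ((1 + r : ℕ) : ℕ∞) := by
      by_cases hne : ∃ u, 0 < γ u ∧ j ∈ u
      · obtain ⟨u, hu, hju⟩ := hne
        have hsub : {w | 0 < γ w ∧ j ∈ w} ⊆ {w | 0 < γ w ∧ (u ∩ w).Nonempty} := fun w hw =>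
          ⟨hw.1, j, Finset.mem_inter.2 ⟨hju, hw.2⟩⟩
        exact (Set.encard_le_encard hsub).trans ((hr u hu).trans_eq (by simp))
      · have : {u | 0 < γ u ∧ j ∈ u} = ∅ := Set.eq_empty_of_forall_notMem fun u hu => hne ⟨u, hu.1, hu.2⟩
        simp [this]
    have h2 : {u | 0 < γ u ∧ ¬ Disjoint u (insert j v)} ⊆
        {u | 0 < γ u ∧ j ∈ u} ∪ {u | 0 < γ u ∧ ¬ Disjoint u v} := by
      rintro u ⟨hu, hd⟩
      rw [Finset.disjoint_insert_right, not_and_or, not_not] at hd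
      exact hd.imp (fun h => ⟨hu, h⟩) fun h => ⟨hu, h⟩
    refine (Set.encard_le_encard h2).trans ((Set.encard_union_le _ _).trans
      ((add_le_add h1 ih).trans_eq ?_))
    rw [Finset.card_insert_of_notMem hj, ← Nat.cast_add]
    congr 1
    ring

/-- Changing finitely many coordinates alters only finitely many terms of the series, or, for
product weights, finitely many terms of the equivalent sum over single variables. -/
theorem anchoredSubspace_subset_infDomain (hk_pos : ∀ a, 0 < k a a) (hγ : ∀ u, 0 ≤ γ u)
    (h : IsFiniteIntersectionWeights γ ∨ IsProductWeights γ) {b : ℕ+ → D}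
    (hb : b ∈ infDomain k γ) (v : Finset ℕ+) : anchoredSubspace v b ⊆ infDomain k γ := by
  intro x hx
  rcases h with ⟨-, r, hr⟩ | ⟨g, hg0, -, hg⟩
  · refine Summable.congr_cofinite hb ?_
    have hfin : {u | 0 < γ u ∧ ¬ Disjoint u v}.Finite :=
      Set.finite_of_encard_le_coe (encard_inter_le_of_finiteIntersection hr v)
    refine hfin.subset fun u hu => ?_
    by_contra hcon
    refine hu ?_
    rcases (hγ u).eq_or_lt with h0 | h0
    · simp [← h0]
    · have hd : Disjoint u v := by
        by_contra hd
        exact hcon ⟨h0, hd⟩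
      have hxb : ∀ j ∈ u, b j = x j := fun j hj => (hx j (Finset.disjoint_left.1 hd hj)).symm
      exact congrArg _ (prodKernel_congr hxb hxb)
  · rw [mem_infDomain_product_iff hk_pos hg0 hg] at hb ⊢
    refine Summable.congr_cofinite hb ?_
    refine v.finite_toSet.subset fun j hj => ?_
    by_contra hcon
    have hxj : x j = b j := hx j hcon
    exact hj (show g j * k (b j) (b j) = g j * k (x j) (x j) by rw [hxj])

/-! ### Weights of the variables outside a finite set -/

/-- For all `v` with at most `m` elements, the weights of the sets disjoint from `v` sum up to at
least `c * m ^ (1 - p)`. -/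
def HasTailWeights (k : D → D → ℝ) (γ : Finset ℕ+ → ℝ) (c p : ℝ) (m : ℕ) : Prop :=
  ∀ v : Finset ℕ+, v.card ≤ m → ∀ b : ℕ+ → D, ∃ U : Finset (Finset ℕ+), ∅ ∉ U ∧
    (∀ u ∈ U, Disjoint u v) ∧ c * (m : ℝ) ^ (1 - p) ≤ ∑ u ∈ U, γ u * prodKernel k u b b

/-- Among the first `j ≥ 2 * R * m` sets at most `R * m` meet `v`; the remaining `j / 2` or more
weigh at least `δ * j^(-p)` each. Since `1 - p < 0`, the bound `j ≤ 4 * R * m` turns `j^(1-p)` into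
a multiple of `m^(1-p)`. -/
theorem hasTailWeights_of_listing {e : ℕ+ → Finset ℕ+} (he : Function.Injective e)
    (hne : ∀ j, (e j).Nonempty) {w : ℕ+ → ℝ} (hw : Antitone w)
    (hwe : ∀ j (b : ℕ+ → D), w j ≤ γ (e j) * prodKernel k (e j) b b) {R : ℕ} (hR : 1 ≤ R)
    (hcard : ∀ (J : Finset ℕ+) (v : Finset ℕ+),
      (J.filter fun i => ¬ Disjoint (e i) v).card ≤ R * v.card)
    {δ p : ℝ} (hδ : 0 < δ) (hp : 1 < p) {j : ℕ+} {m : ℕ} (hjm : 2 * R * m ≤ j)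
    (hjm' : (j : ℕ) ≤ 4 * R * m) (hj : δ * ((j : ℕ) : ℝ) ^ (-p) ≤ w j) :
    HasTailWeights k γ (δ / 2 * (4 * R : ℝ) ^ (1 - p)) p m := by
  intro v hv b
  have hj0 : (0 : ℝ) < ((j : ℕ) : ℝ) := by exact_mod_cast j.pos
  set J := (Finset.Icc 1 j).filter fun i => Disjoint (e i) v with hJ
  refine ⟨J.map ⟨e, he⟩, fun h => ?_, fun u hu => ?_, ?_⟩
  · obtain ⟨i, -, hi⟩ := Finset.mem_map.1 h
    exact (hne i).ne_empty hi
  · obtain ⟨i, hi, rfl⟩ := Finset.mem_map.1 hu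
    exact (Finset.mem_filter.1 hi).2
  · rw [Finset.sum_map]
    have h1 : ((j : ℕ) : ℝ) / 2 ≤ J.card := by
      have h2 := Finset.card_filter_add_card_filter_not (s := Finset.Icc 1 j)
        fun i => Disjoint (e i) v
      have h3 := (hcard (Finset.Icc 1 j) v).trans (Nat.mul_le_mul_left R hv)
      rw [PNat.card_Icc, PNat.one_coe, Nat.add_sub_cancel, ← hJ] at h2
      have h4 : (j : ℕ) ≤ 2 * J.card := by nlinarith
      have : ((j : ℕ) : ℝ) ≤ 2 * (J.card : ℝ) := by exact_mod_cast h4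
      linarith
    have h5 := Finset.card_nsmul_le_sum J (fun i => γ (e i) * prodKernel k (e i) b b) (w j)
      fun i hi => (hw (Finset.mem_Icc.1 (Finset.mem_filter.1 hi).1).2).trans (hwe i b)
    rw [nsmul_eq_mul] at h5
    refine le_trans ?_ h5
    calc δ / 2 * (4 * R : ℝ) ^ (1 - p) * (m : ℝ) ^ (1 - p)
        = δ / 2 * ((4 * R * m : ℝ)) ^ (1 - p) := by
          rw [Real.mul_rpow (x := 4 * (R : ℝ)) (by positivity) (by positivity)]; ring
      _ ≤ δ / 2 * ((j : ℕ) : ℝ) ^ (1 - p) := by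
          gcongr ?_ * ?_
          exact Real.rpow_le_rpow_of_nonpos hj0 (by exact_mod_cast hjm') (by linarith)
      _ = ((j : ℕ) : ℝ) / 2 * (δ * ((j : ℕ) : ℝ) ^ (-p)) := by
          rw [sub_eq_add_neg, Real.rpow_add hj0, Real.rpow_one]; ring
      _ ≤ J.card * w j := by gcongr

theorem frequently_hasTailWeights_of_listing {w : ℕ+ → ℝ} {R : ℕ} (hR : 1 ≤ R) {δ p c : ℝ}
    (h : ∀ (j : ℕ+) (m : ℕ), 2 * R * m ≤ j → (j : ℕ) ≤ 4 * R * m →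
      δ * ((j : ℕ) : ℝ) ^ (-p) ≤ w j → HasTailWeights k γ c p m)
    (hw : ∃ᶠ j : ℕ+ in atTop, δ * ((j : ℕ) : ℝ) ^ (-p) ≤ w j) :
    ∃ᶠ m : ℕ in atTop, HasTailWeights k γ c p m := by
  rw [frequently_atTop] at hw ⊢
  intro n
  -- The witness is `m = ⌊j / (2R)⌋`. This choice of `j` makes `m ≥ 1`, hence `j < 2R(m + 1) ≤ 4Rm`.
  obtain ⟨j, hj, hwj⟩ := hw ⟨2 * R * (n + 1), by positivity⟩
  have hj' : 2 * R * (n + 1) ≤ (j : ℕ) := hj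
  have hR2 : 0 < 2 * R := by omega
  have hm : n + 1 ≤ (j : ℕ) / (2 * R) := by
    rw [Nat.le_div_iff_mul_le hR2]
    linarith
  refine ⟨(j : ℕ) / (2 * R), by omega, h j _ (Nat.mul_div_le _ _) ?_ hwj⟩
  have h1 := Nat.lt_mul_div_succ (j : ℕ) hR2
  nlinarith

theorem eventually_hasTailWeights_of_listing {w : ℕ+ → ℝ} {R : ℕ} (hR : 1 ≤ R) {δ p c : ℝ}
    (h : ∀ (j : ℕ+) (m : ℕ), 2 * R * m ≤ j → (j : ℕ) ≤ 4 * R * m →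
      δ * ((j : ℕ) : ℝ) ^ (-p) ≤ w j → HasTailWeights k γ c p m)
    (hw : ∀ j : ℕ+, δ * ((j : ℕ) : ℝ) ^ (-p) ≤ w j) :
    ∀ᶠ m : ℕ in atTop, HasTailWeights k γ c p m := by
  filter_upwards [eventually_ge_atTop 1] with m hm
  refine h ⟨2 * R * m, by positivity⟩ m le_rfl ?_ (hw _)
  simp only [PNat.mk_coe]
  nlinarith

theorem listing_card_le_product (J v : Finset ℕ+) :
    (J.filter fun i => ¬ Disjoint ({i} : Finset ℕ+) v).card ≤ 1 * v.card := by
  rw [one_mul]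
  exact Finset.card_le_card fun i hi => by simpa using (Finset.mem_filter.1 hi).2

theorem listing_card_le_finiteIntersection {r : ℕ}
    (hr : ∀ u, 0 < γ u → {v | 0 < γ v ∧ (u ∩ v).Nonempty}.encard ≤ 1 + (r : ℕ∞))
    {e : ℕ+ → Finset ℕ+} (he : Function.Injective e) (hpos : ∀ j, 0 < γ (e j))
    (J v : Finset ℕ+) :
    (J.filter fun i => ¬ Disjoint (e i) v).card ≤ (1 + r) * v.card := by
  have h := encard_inter_le_of_finiteIntersection hr v
  rw [← Finset.card_map ⟨e, he⟩, ← ENat.natCast_le_natCast, ← Set.encard_coe_eq_coe_finsetCard]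
  refine (Set.encard_le_encard fun u hu => ?_).trans h
  obtain ⟨i, hi, rfl⟩ := Finset.mem_map.1 (Finset.mem_coe.1 hu)
  exact ⟨hpos i, (Finset.mem_filter.1 hi).2⟩

/-- Passing from `a` to `b` costs a factor `θ = min 1 (κ / k a a)` per variable; as `θ ≤ 1` and `|u|
≤ ω`, the loss is at most `θ^ω`, uniformly in `u` and `b`. -/
theorem anchoredWeight_le_of_kernel_lower_bound {κ : ℝ} (hκ : 0 < κ) (hκk : ∀ x, κ ≤ k x x)
    (hγ : ∀ u, 0 ≤ γ u) {ω : ℕ} (hω : ∀ u : Finset ℕ+, ω < u.card → γ u = 0) (a : D)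
    (u : Finset ℕ+) (b : ℕ+ → D) :
    min 1 (κ / k a a) ^ ω * anchoredWeight k γ (fun _ => a) u ≤ γ u * prodKernel k u b b := by
  have ha : 0 < k a a := hκ.trans_le (hκk a)
  set θ := min 1 (κ / k a a)
  have hθ0 : 0 ≤ θ := le_min zero_le_one (div_pos hκ ha).le
  by_cases hu : ω < u.card
  · simp [anchoredWeight, hω u hu]
  · rw [anchoredWeight, mul_left_comm]
    refine mul_le_mul_of_nonneg_left ?_ (hγ u)
    calc θ ^ ω * prodKernel k u (fun _ => a) (fun _ => a)
        ≤ θ ^ u.card * prodKernel k u (fun _ => a) (fun _ => a) := by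
          refine mul_le_mul_of_nonneg_right ?_ (Finset.prod_nonneg fun _ _ => ha.le)
          exact pow_le_pow_of_le_one hθ0 (min_le_left _ _) (not_lt.1 hu)
      _ = ∏ _j ∈ u, θ * k a a := by
          rw [prodKernel, Finset.prod_mul_distrib, Finset.prod_const θ]
      _ ≤ prodKernel k u b b := by
          refine Finset.prod_le_prod (fun _ _ => mul_nonneg hθ0 ha.le) fun j _ => ?_
          calc θ * k a a ≤ κ / k a a * k a a := by gcongr; exact min_le_right _ _
            _ = κ := div_mul_cancel₀ _ ha.ne'
            _ ≤ _ := hκk _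

theorem exists_hasTailWeights (hk_pos : ∀ a, 0 < k a a) (hγ : ∀ u, 0 ≤ γ u)
    (h : IsFiniteIntersectionWeights γ ∨ IsProductWeights γ) {κ : ℝ} (hκ : 0 < κ)
    (hκk : ∀ x, κ ≤ k x x) {a : D} (ha : (fun _ => a) ∈ infDomain k γ) {p : ℝ}
    (hp : decay k γ (fun _ => a) < (p : EReal)) :
    (∃ c > 0, ∃ᶠ m : ℕ in atTop, HasTailWeights k γ c p m) ∧
      (PolynomialLowerBound k γ (fun _ => a) p →
        ∃ c > 0, ∀ᶠ m : ℕ in atTop, HasTailWeights k γ c p m) := by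
  have hp1 := one_lt_of_decay_lt hk_pos hγ ha hp
  have hprod : ∀ {g : ℕ+ → ℝ}, Antitone g → (∀ u, γ u = ∏ j ∈ u, g j) →
      ∀ {δ : ℝ}, 0 < δ → ∀ (j : ℕ+) (m : ℕ), 2 * 1 * m ≤ j → (j : ℕ) ≤ 4 * 1 * m →
      δ * ((j : ℕ) : ℝ) ^ (-p) ≤ κ * g j →
      HasTailWeights k γ (δ / 2 * (4 * (1 : ℕ) : ℝ) ^ (1 - p)) p m := by
    intro g hga hg δ hδ j m h1 h2 h3
    refine hasTailWeights_of_listing (w := fun j => κ * g j) Finset.singleton_injective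
      Finset.singleton_nonempty (fun i j hij => mul_le_mul_of_nonneg_left (hga hij) hκ.le)
      (fun j b => ?_) le_rfl listing_card_le_product hδ hp1 h1 h2 h3
    have hgj : 0 ≤ g j := by simpa [hg] using hγ {j}
    rw [hg, Finset.prod_singleton, prodKernel_singleton, mul_comm]
    exact mul_le_mul_of_nonneg_left (hκk _) hgj
  have hfin : ∀ {ω r : ℕ}, (∀ u : Finset ℕ+, ω < u.card → γ u = 0) →
      (∀ u, 0 < γ u → {v | 0 < γ v ∧ (u ∩ v).Nonempty}.encard ≤ 1 + (r : ℕ∞)) →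
      ∀ {e}, IsDecreasingListing k γ (fun _ => a) e → ∀ {δ : ℝ}, 0 < δ →
      ∀ (j : ℕ+) (m : ℕ), 2 * (1 + r) * m ≤ j → (j : ℕ) ≤ 4 * (1 + r) * m →
      δ * ((j : ℕ) : ℝ) ^ (-p) ≤ anchoredWeight k γ (fun _ => a) (e j) →
      HasTailWeights k γ
        (min 1 (κ / k a a) ^ ω * δ / 2 * (4 * (1 + r : ℕ) : ℝ) ^ (1 - p)) p m := by
    intro ω r hω hr e he δ hδ j m h1 h2 h3
    have hθ : 0 < min 1 (κ / k a a) ^ ω :=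
      pow_pos (lt_min zero_lt_one (div_pos hκ (hk_pos a))) ω
    have hmem : ∀ j, (e j).Nonempty ∧ 0 < γ (e j) := fun j => by
      have : e j ∈ Set.range e := ⟨j, rfl⟩
      rwa [he.2.1] at this
    refine hasTailWeights_of_listing
      (w := fun j => min 1 (κ / k a a) ^ ω * anchoredWeight k γ (fun _ => a) (e j))
      he.1 (fun j => (hmem j).1) (fun i j hij => mul_le_mul_of_nonneg_left (he.2.2 hij) hθ.le)
      (fun j b => anchoredWeight_le_of_kernel_lower_bound hκ hκk hγ hω a (e j) b)
      (by omega) (listing_card_le_finiteIntersection hr he.1 fun j => (hmem j).2)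
      (mul_pos hθ hδ) hp1 h1 h2 ?_
    rw [mul_assoc]
    exact mul_le_mul_of_nonneg_left h3 hθ.le
  have hfinpos : ∀ {ω r : ℕ} {δ : ℝ}, 0 < δ →
      0 < min 1 (κ / k a a) ^ ω * δ / 2 * (4 * (1 + r : ℕ) : ℝ) ^ (1 - p) := fun hδ => by
    have : 0 < min 1 (κ / k a a) := lt_min zero_lt_one (div_pos hκ (hk_pos a))
    positivity
  constructor
  · rcases h with ⟨⟨ω, hω⟩, r, hr⟩ | ⟨g, hg0, hga, hg⟩
    · obtain ⟨e, he, hnot⟩ := exists_listing_not_tendsto hp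
      obtain ⟨δ, hδ, hfreq⟩ := exists_frequently_le_of_not_tendsto
        (fun j => anchoredWeight_nonneg hk_pos hγ _ (e j)) hnot
      exact ⟨_, hfinpos hδ,
        frequently_hasTailWeights_of_listing (by omega) (hfin hω hr he hδ) hfreq⟩
    · refine ⟨_, by positivity,
        frequently_hasTailWeights_of_listing le_rfl (hprod hga hg hκ) ?_⟩
      exact (exists_frequently_le_of_decay_lt_product hk_pos hg0 hg ha hp).mono fun j hj =>
        mul_le_mul_of_nonneg_left hj hκ.le
  · rintro (⟨⟨⟨ω, hω⟩, r, hr⟩, hlow⟩ | ⟨⟨g, hg0, hga, hg⟩, c, hc, hlow⟩)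
    -- The decay assumption serves to provide a listing; without one the lower bound would be
    -- vacuous.
    · obtain ⟨e, he, -⟩ := exists_listing_not_tendsto hp
      obtain ⟨c, hc, hce⟩ := hlow e he
      exact ⟨_, hfinpos hc,
        eventually_hasTailWeights_of_listing (by omega) (hfin hω hr he hc) hce⟩
    · refine ⟨_, by positivity, eventually_hasTailWeights_of_listing le_rfl
        (hprod hga hg (mul_pos hκ hc)) fun j => ?_⟩
      have := hlow j
      rw [hg, Finset.prod_singleton] at this
      rw [mul_assoc]
      exact mul_le_mul_of_nonneg_left this hκ.le

end Weights

/-! ### Lower bounds for algorithms on the unit ball -/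

/-- Monotonicity in the budget covers the bounded range below the threshold, at the price of a
smaller constant. -/
theorem exists_univariate_lower_bound {D : Set ℝ} {ρ : Measure D} {k : D → D → ℝ}
    {γ : Finset ℕ+ → ℝ} {α : ℝ} (hα : 0 < α)
    (h : ∃ c : ℝ, 0 < c ∧ ∀ᶠ N : ℝ in atTop,
      ENNReal.ofReal (c * N ^ (-α)) ≤ univariateMinError k ρ γ N ^ 2) :
    ∃ c > 0, ∀ N : ℝ, 1 ≤ N →
      ENNReal.ofReal (c * N ^ (-α)) ≤ univariateMinError k ρ γ N ^ 2 := by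
  obtain ⟨c, hc, h⟩ := h
  obtain ⟨N₀, hN₀⟩ := eventually_atTop.1 h
  set N₁ := max N₀ 1
  have hN₁ : 1 ≤ N₁ := le_max_right _ _
  have hp : ∀ N : ℝ, 1 ≤ N → N ^ (-α) ≤ 1 := fun N hN =>
    Real.rpow_le_one_of_one_le_of_nonpos hN (by linarith)
  have hpos : ∀ N : ℝ, 1 ≤ N → 0 < N ^ (-α) := fun N hN => Real.rpow_pos_of_pos (by linarith) _
  refine ⟨c * N₁ ^ (-α), mul_pos hc (hpos _ hN₁), fun N hN => ?_⟩
  by_cases hNN : N₁ ≤ N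
  · refine le_trans (ENNReal.ofReal_le_ofReal ?_) (hN₀ N ((le_max_left _ _).trans hNN))
    have := mul_le_of_le_one_right hc.le (hp _ hN₁)
    exact mul_le_mul_of_nonneg_right this (hpos N hN).le
  · refine le_trans (ENNReal.ofReal_le_ofReal ?_) ((hN₀ N₁ (le_max_left _ _)).trans
      (pow_le_pow_left' (minError_anti (not_le.1 hNN).le) 2))
    exact mul_le_of_le_one_right (mul_pos hc (hpos _ hN₁)).le (hp N hN)

section LowerBounds

variable {D : Set ℝ} {ρ : Measure D} [IsProbabilityMeasure ρ] {k : D → D → ℝ}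
  {γ : Finset ℕ+ → ℝ} {C : Set ((ℕ+ → D) → ℝ≥0∞)}

theorem le_error_sq_of_hasTailWeights (hk_meas : Measurable (Function.uncurry k))
    (hk : (Matrix.of k).PosSemidef) (hk_int : Integrable (fun x => k x x) ρ)
    (hk_anova : ∀ y, ∫ x, k x y ∂ρ = 0) (hk_pos : ∀ a, 0 < k a a) (hγ : ∀ u, 0 ≤ γ u)
    (hγ_empty : γ ∅ = 1)
    (hγ_sum : Summable fun u : Finset ℕ+ => γ u * (∫ x, k x x ∂ρ) ^ u.card)
    (Q : RandAlgorithm (infUnitBall k γ) C) {c : (ℕ+ → D) → ℝ≥0∞} (hc : c ∈ C) {N : ℝ}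
    (hN : 0 < N)
    (hcost : ∀ f ∈ infUnitBall k γ, ∫⁻ ω, (Q.alg ω).cost c f ∂Q.P ≤ ENNReal.ofReal N)
    {v : Finset ℕ+} {b : ℕ+ → D}
    (hcv : ∀ x, c x < ENNReal.ofReal (4 * N) → x ∈ anchoredSubspace v b)
    {δ p : ℝ} (hδ : 0 < δ) (hp : 1 < p) {m : ℕ} (hm : 1 ≤ m) (hv : v.card ≤ m)
    (htail : HasTailWeights k γ δ p m) :
    ENNReal.ofReal (3 / 8 * min δ 1 * (m : ℝ) ^ (1 - p)) ≤ Q.error (infIntegral ρ) ^ 2 := by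
  obtain ⟨U, hU, hdisj, hS⟩ := htail v hv b
  set S := ∑ u ∈ U, γ u * prodKernel k u b b with hSdef
  have hm0 : (1 : ℝ) ≤ m := by exact_mod_cast hm
  have hmp : 0 < (m : ℝ) ^ (1 - p) := Real.rpow_pos_of_pos (by linarith) _
  have hmp1 : (m : ℝ) ^ (1 - p) ≤ 1 := Real.rpow_le_one_of_one_le_of_nonpos hm0 (by linarith)
  -- The normalized fooling function has squared integral `S / (S + 1)`, which is at least `S₀ / 2`
  -- whenever `S₀ ≤ S` and `S₀ ≤ 1`; capping `δ` at one covers large `S`.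
  set S₀ := min δ 1 * (m : ℝ) ^ (1 - p) with hS₀
  have hS₀S : S₀ ≤ S := le_trans (by rw [hS₀]; gcongr; exact min_le_left _ _) hS
  have hS₀pos : 0 < S₀ := mul_pos (lt_min hδ one_pos) hmp
  have hS₀1 : S₀ ≤ 1 := mul_le_one₀ (min_le_right _ _) hmp.le hmp1
  have hSpos : 0 < S := hS₀pos.trans_le hS₀S
  have hden : 0 < S ^ 2 + S := by positivity
  set l := (√(S ^ 2 + S))⁻¹ with hl
  have hl2 : l ^ 2 = (S ^ 2 + S)⁻¹ := by rw [hl, inv_pow, Real.sq_sqrt hden.le]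
  let φ : ℝ → (ℕ+ → D) → ℝ := fun t =>
    (infDomain k γ).indicator fun x => t * foolingFunction k γ U b x
  have hφmem : ∀ t, t ^ 2 = l ^ 2 → φ t ∈ infUnitBall k γ := fun t ht =>
    foolingFunction_mem_infUnitBall hk hk_pos hγ hγ_empty hU b rfl
      (by rw [ht, hl2, inv_mul_cancel₀ hden.ne'])
  have hφI : ∀ t, infIntegral ρ (φ t) = t * S := fun t => by
    rw [infIntegral_indicator_infDomain hk hk_int hγ hγ_sum,
      infIntegral_foolingFunction hk_meas hk hk_int hk_anova hU]
  have hneg : -φ l = φ (-l) := by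
    funext x
    by_cases hx : x ∈ infDomain k γ <;> simp [φ, hx]
  have h := Q.le_error_sq_of_vanishing hc (I := infIntegral ρ) (f := φ l) (hφmem l rfl)
    (hneg ▸ hφmem (-l) (neg_sq l)) (by rw [hneg, hφI, hφI]; ring) hN (fun x hx => by
      by_cases hxX : x ∈ infDomain k γ
      · simp [φ, hxX, foolingFunction_eq_zero hdisj (hcv x hx)]
      · simp [φ, hxX]) (hcost _ (hφmem l rfl))
  refine le_trans (ENNReal.ofReal_le_ofReal ?_) h
  rw [hφI, mul_pow, hl2, mul_assoc, ← hS₀]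
  have : S₀ / 2 ≤ (S ^ 2 + S)⁻¹ * S ^ 2 := by
    rw [inv_mul_eq_div, div_le_div_iff₀ two_pos hden]
    nlinarith [mul_nonneg hSpos.le (sub_nonneg.2 hS₀S), mul_nonneg hSpos.le
      (mul_nonneg hSpos.le (sub_nonneg.2 hS₀1))]
  linarith

theorem le_error_sq_of_univariate (hk : (Matrix.of k).PosSemidef)
    (hk_int : Integrable (fun x => k x x) ρ) (hγ : ∀ u, 0 ≤ γ u)
    (hγ_sum : Summable fun u : Finset ℕ+ => γ u * (∫ x, k x x ∂ρ) ^ u.card)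
    (Q : RandAlgorithm (infUnitBall k γ) C) {c : (ℕ+ → D) → ℝ≥0∞} (hc : c ∈ C) {N : ℝ}
    (hcost : ∀ f ∈ infUnitBall k γ, ∫⁻ ω, (Q.alg ω).cost c f ∂Q.P ≤ ENNReal.ofReal N)
    {q : ℝ} (hq : 0 < q) (hqc : ∀ x, ENNReal.ofReal q ≤ c x)
    (hcX : ∀ x, c x < ⊤ → x ∈ infDomain k γ) {M : ℝ} (hM : N / q ≤ M) :
    univariateMinError k ρ γ M ^ 2 ≤ Q.error (infIntegral ρ) ^ 2 := by
  refine pow_le_pow_left' ((minError_anti hM).trans (Q.minError_one_le_error hc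
    (fun g hg => indicator_mem_infUnitBall_of_mem_weightedKernel hk hγ hg)
    (fun g _ => infIntegral_indicator_infDomain hk hk_int hγ hγ_sum g) hcX hq hqc hcost)) 2

theorem exists_kernel_lower_bound (hk_meas : Measurable (Function.uncurry k))
    (hk : (Matrix.of k).PosSemidef) (hk_int : Integrable (fun x => k x x) ρ)
    (hk_anova : ∀ y, ∫ x, k x y ∂ρ = 0) (hk_pos : ∀ a, 0 < k a a) (hγ : ∀ u, 0 ≤ γ u)
    (hγ_empty : γ ∅ = 1) {c : ℝ} (hc : 0 < c)
    (h : ENNReal.ofReal c ≤ univariateMinError k ρ γ 1 ^ 2) (a : D) :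
    ∃ κ > 0, ∀ x, κ ≤ k x x := by
  have hck : ∀ x, c ≤ γ {1} * k x x := fun x => by
    have h1 := h.trans (minError_one_sq_le (fun _ => x) fun f hf =>
      univariate_sq_sub_integral_le hk_meas hk hk_int hk_anova hγ_empty hf _)
    exact (ENNReal.ofReal_le_ofReal_iff (mul_nonneg (hγ _) (hk_pos x).le)).1 h1
  have hγ1 : 0 < γ {1} := pos_of_mul_pos_left (hc.trans_le (hck a)) (hk_pos a).le
  exact ⟨c / γ {1}, div_pos hc hγ1, fun x => (div_le_iff₀' hγ1).2 (hck x)⟩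

/-! ### The two cost models -/

variable {price : ℕ → ℝ≥0} {𝒜 : Set (ℕ+ → D)}

theorem mem_of_fixedCost_lt_top {v : Finset ℕ+} {b x : ℕ+ → D}
    (h : fixedCost price v b x < ⊤) : x ∈ anchoredSubspace v b := by
  by_contra hx
  simp [fixedCost, hx] at h

theorem ofReal_le_fixedCost {v : Finset ℕ+} {b : ℕ+ → D} {q : ℝ} (hq : q ≤ price v.card)
    (x : ℕ+ → D) : ENNReal.ofReal q ≤ fixedCost price v b x := by
  unfold fixedCost
  split_ifs
  · exact ENNReal.ofReal_le_of_le_toReal hq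
  · exact le_top

theorem exists_of_varCost_lt {v : ℕ → Finset ℕ+} {b x : ℕ+ → D} {T : ℝ≥0∞}
    (h : varCost price v b x < T) :
    ∃ i, x ∈ anchoredSubspace (v i) b ∧ (price (v i).card : ℝ≥0∞) < T := by
  obtain ⟨i, hi⟩ := iInf_lt_iff.1 h
  obtain ⟨hx, hi⟩ := iInf_lt_iff.1 hi
  exact ⟨i, hx, hi⟩

/-- Cardinalities increase strictly along the chain, so only indices up to `m` qualify, and the last
qualifying set contains the others. -/
theorem exists_bound_of_strictMono {v : ℕ → Finset ℕ+} (hv : StrictMono v) (m : ℕ) :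
    ∃ w : Finset ℕ+, w.card ≤ m ∧ ∀ i, (v i).card ≤ m → v i ⊆ w := by
  classical
  have hcard : StrictMono fun i => (v i).card := fun i j hij => Finset.card_lt_card (hv hij)
  by_cases hex : ∃ i, (v i).card ≤ m
  · obtain ⟨i, hi⟩ := hex
    have him : ∀ j, (v j).card ≤ m → j ≤ m := fun j hj => (hcard.id_le j).trans hj
    refine ⟨v (Nat.findGreatest (fun j => (v j).card ≤ m) m),
      Nat.findGreatest_spec (P := fun j => (v j).card ≤ m) (him i hi) hi, fun j hj => ?_⟩
    exact hv.monotone (Nat.le_findGreatest (him j hj) hj)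
  · exact ⟨∅, by simp, fun i hi => absurd ⟨i, hi⟩ hex⟩

theorem anchoredSubspace_mono {v w : Finset ℕ+} (h : v ⊆ w) (b : ℕ+ → D) :
    anchoredSubspace v b ⊆ anchoredSubspace w b :=
  fun _ hx j hj => hx j fun hjv => hj (h hjv)

theorem le_fixedMinError_sq (hk_meas : Measurable (Function.uncurry k))
    (hk : (Matrix.of k).PosSemidef) (hk_int : Integrable (fun x => k x x) ρ)
    (hk_anova : ∀ y, ∫ x, k x y ∂ρ = 0) (hk_pos : ∀ a, 0 < k a a) (hγ : ∀ u, 0 ≤ γ u)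
    (hγ_empty : γ ∅ = 1)
    (hγ_sum : Summable fun u : Finset ℕ+ => γ u * (∫ x, k x x ∂ρ) ^ u.card)
    (hsub : ∀ b ∈ 𝒜, ∀ v, anchoredSubspace v b ⊆ infDomain k γ)
    {s c₀ : ℝ} (hs : 0 < s) (hc₀ : 0 < c₀)
    (h_price : ∀ ν : ℕ, 1 ≤ ν → c₀ * (ν : ℝ) ^ s ≤ price ν) {α : ℝ} (hα : 0 < α) {c₁ : ℝ}
    (h_univ : ∀ N : ℝ, 1 ≤ N →
      ENNReal.ofReal (c₁ * N ^ (-α)) ≤ univariateMinError k ρ γ N ^ 2)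
    {δ p : ℝ} (hδ : 0 < δ) (hp : 1 < p) {m : ℕ} (htail : HasTailWeights k γ δ p m) {N : ℝ}
    (hN : 1 ≤ N) (hNm : N ^ (α / (α * s + p - 1)) ≤ m)
    (hmN : m ≤ 2 * N ^ (α / (α * s + p - 1))) :
    ENNReal.ofReal (min (3 / 8 * min δ 1 * 2 ^ (1 - p)) (c₁ * (max 1 (2 / c₀)) ^ (-α)) *
      N ^ (-(α * (p - 1) / (α * s + p - 1)))) ≤ fixedMinError k ρ γ price 𝒜 N ^ 2 := by
  have hN0 : 0 < N := by linarith
  have hden : 0 < α * s + p - 1 := by nlinarith [mul_pos hα hs]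
  set β := α / (α * s + p - 1) with hβ
  have hβ0 : 0 < β := div_pos hα hden
  have hNβ : 1 ≤ N ^ β := Real.one_le_rpow hN hβ0.le
  have hm1 : 1 ≤ m := by exact_mod_cast hNβ.trans hNm
  have hpow : 0 < N ^ (-(α * (p - 1) / (α * s + p - 1))) := Real.rpow_pos_of_pos hN0 _
  refine le_minError_sq fun Q hQ => ?_
  obtain ⟨_, hcC, hcost⟩ := Q.exists_cost_of_worstCost_le hN0.le hQ
  obtain ⟨v, b, hb, rfl⟩ := id hcC
  -- Small `v`: the fooling bound applies. Large `v`: every evaluation is expensive and the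
  -- univariate bound applies.
  by_cases hv : v.card ≤ m
  · refine le_trans (ENNReal.ofReal_le_ofReal ?_) (le_error_sq_of_hasTailWeights hk_meas hk hk_int
      hk_anova hk_pos hγ hγ_empty hγ_sum Q hcC (by linarith) hcost
      (fun x hx => mem_of_fixedCost_lt_top (hx.trans_le le_top)) hδ hp hm1 hv htail)
    have h1 : (2 : ℝ) ^ (1 - p) * N ^ (-(α * (p - 1) / (α * s + p - 1))) ≤ (m : ℝ) ^ (1 - p) := by
      have : N ^ (-(α * (p - 1) / (α * s + p - 1))) = (N ^ β) ^ (1 - p) := by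
        rw [← Real.rpow_mul hN0.le, hβ]
        congr 1
        ring
      rw [this, ← Real.mul_rpow two_pos.le (by positivity)]
      exact Real.rpow_le_rpow_of_nonpos (by linarith) hmN (by linarith)
    calc _ ≤ 3 / 8 * min δ 1 * 2 ^ (1 - p) * N ^ (-(α * (p - 1) / (α * s + p - 1))) := by
          gcongr; exact min_le_left _ _
      _ = 3 / 8 * min δ 1 * (2 ^ (1 - p) * N ^ (-(α * (p - 1) / (α * s + p - 1)))) := by ring
      _ ≤ _ := by
          have : 0 < min δ 1 := lt_min hδ one_pos
          gcongr
  · have hvm : (m : ℝ) ≤ v.card := by exact_mod_cast (not_le.1 hv).le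
    have hq : c₀ * (N ^ β) ^ s ≤ price v.card := by
      refine le_trans ?_ (h_price v.card (by omega))
      gcongr
      exact hNm.trans hvm
    set B := max 1 (2 / c₀)
    have hB : 1 ≤ B := le_max_left _ _
    have hexp : 1 - β * s = (p - 1) / (α * s + p - 1) := by
      rw [hβ]
      field_simp
      ring
    have hexp0 : 0 ≤ 1 - β * s := by
      rw [hexp]
      exact div_nonneg (by linarith) hden.le
    have hM1 : 1 ≤ B * N ^ (1 - β * s) := one_le_mul_of_one_le_of_one_le hB
      (Real.one_le_rpow hN hexp0)
    have hM : (N + 1) / (c₀ * (N ^ β) ^ s) ≤ B * N ^ (1 - β * s) := by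
      rw [← Real.rpow_mul hN0.le, Real.rpow_sub hN0, Real.rpow_one, ← mul_div_assoc,
        div_le_div_iff₀ (by positivity) (by positivity)]
      -- Here `N + 1 ≤ 2 * N`, and `B ≥ 2 / c₀`.
      have h2 : N + 1 ≤ B * N * c₀ := by
        have := le_max_right 1 (2 / c₀)
        rw [div_le_iff₀ hc₀] at this
        nlinarith
      have h3 : 0 < N ^ (β * s) := Real.rpow_pos_of_pos hN0 _
      nlinarith
    refine le_trans (le_trans (ENNReal.ofReal_le_ofReal ?_) (h_univ _ hM1))
      (le_error_sq_of_univariate hk hk_int hγ hγ_sum Q hcC hcost (by positivity)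
        (ofReal_le_fixedCost hq)
        (fun x hx => hsub b hb v (mem_of_fixedCost_lt_top hx)) hM)
    have h4 : (B * N ^ (1 - β * s)) ^ (-α) =
        B ^ (-α) * N ^ (-(α * (p - 1) / (α * s + p - 1))) := by
      rw [Real.mul_rpow (by linarith) (by positivity), ← Real.rpow_mul hN0.le, hexp]
      congr 2
      ring
    rw [h4, ← mul_assoc]
    gcongr
    exact min_le_right _ _

theorem le_varMinError_sq_of_univariate
    (hk : (Matrix.of k).PosSemidef) (hk_int : Integrable (fun x => k x x) ρ)
    (hγ : ∀ u, 0 ≤ γ u)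
    (hγ_sum : Summable fun u : Finset ℕ+ => γ u * (∫ x, k x x ∂ρ) ^ u.card)
    (hsub : ∀ b ∈ 𝒜, ∀ v, anchoredSubspace v b ⊆ infDomain k γ)
    {s c₀ : ℝ} (hs : 0 < s) (hc₀ : 0 < c₀)
    (h_price : ∀ ν : ℕ, 1 ≤ ν → c₀ * (ν : ℝ) ^ s ≤ price ν) {α : ℝ} {c₁ : ℝ}
    (h_univ : ∀ N : ℝ, 1 ≤ N →
      ENNReal.ofReal (c₁ * N ^ (-α)) ≤ univariateMinError k ρ γ N ^ 2)
    {N : ℝ} (hN : 1 ≤ N) :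
    ENNReal.ofReal (c₁ * (max 1 (2 / c₀)) ^ (-α) * N ^ (-α)) ≤
      varMinError k ρ γ price 𝒜 N ^ 2 := by
  have hN0 : 0 < N := by linarith
  refine le_minError_sq fun Q hQ => ?_
  obtain ⟨_, hcC, hcost⟩ := Q.exists_cost_of_worstCost_le hN0.le hQ
  obtain ⟨v, hv, hvne, b, hb, rfl⟩ := id hcC
  set B := max 1 (2 / c₀)
  have hB : 1 ≤ B := le_max_left _ _
  have hM : (N + 1) / c₀ ≤ B * N := by
    have := le_max_right 1 (2 / c₀)
    rw [div_le_iff₀ hc₀] at this ⊢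
    nlinarith
  have hq : ∀ x, ENNReal.ofReal c₀ ≤ varCost price v b x := fun x => by
    refine le_iInf₂ fun i _ => ENNReal.ofReal_le_of_le_toReal ?_
    have hi : 1 ≤ (v i).card := (hvne i).card_pos
    refine le_trans ?_ (h_price _ hi)
    exact le_mul_of_one_le_right hc₀.le (Real.one_le_rpow (by exact_mod_cast hi) hs.le)
  rw [mul_assoc, ← Real.mul_rpow (by linarith) hN0.le]
  refine (h_univ _ (one_le_mul_of_one_le_of_one_le hB hN)).trans
    (le_error_sq_of_univariate hk hk_int hγ hγ_sum Q hcC hcost hc₀ hq (fun x hx => ?_) hM)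
  obtain ⟨i, hxi, -⟩ := exists_of_varCost_lt hx
  exact hsub b hb _ hxi

theorem le_varMinError_sq_of_hasTailWeights (hk_meas : Measurable (Function.uncurry k))
    (hk : (Matrix.of k).PosSemidef) (hk_int : Integrable (fun x => k x x) ρ)
    (hk_anova : ∀ y, ∫ x, k x y ∂ρ = 0) (hk_pos : ∀ a, 0 < k a a) (hγ : ∀ u, 0 ≤ γ u)
    (hγ_empty : γ ∅ = 1)
    (hγ_sum : Summable fun u : Finset ℕ+ => γ u * (∫ x, k x x ∂ρ) ^ u.card)
    {s c₀ : ℝ} (hs : 0 < s) (hc₀ : 0 < c₀)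
    (h_price : ∀ ν : ℕ, 1 ≤ ν → c₀ * (ν : ℝ) ^ s ≤ price ν)
    {δ p : ℝ} (hδ : 0 < δ) (hp : 1 < p) {m : ℕ} (htail : HasTailWeights k γ δ p m) {N : ℝ}
    (hN : 1 ≤ N) (hNm : (8 / c₀) ^ s⁻¹ * N ^ s⁻¹ ≤ m)
    (hmN : m ≤ 2 * ((8 / c₀) ^ s⁻¹ * N ^ s⁻¹)) :
    ENNReal.ofReal (3 / 8 * min δ 1 * (2 * (8 / c₀) ^ s⁻¹) ^ (1 - p) * N ^ (-((p - 1) / s))) ≤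
      varMinError k ρ γ price 𝒜 N ^ 2 := by
  have hN0 : 0 < N := by linarith
  have hm0 : (0 : ℝ) < m := lt_of_lt_of_le (by positivity) hNm
  have hm1 : 1 ≤ m := by exact_mod_cast hm0
  refine le_minError_sq fun Q hQ => ?_
  obtain ⟨_, hcC, hcost⟩ := Q.exists_cost_of_worstCost_le hN0.le hQ
  obtain ⟨v, hv, hvne, b, hb, rfl⟩ := id hcC
  obtain ⟨w, hw, hvw⟩ := exists_bound_of_strictMono hv m
  -- A point cheaper than `4 * (N + 1) ≤ 8 * N` lies in some `𝔛_{v_i,b}` with `|v_i|^s ≤ 8 * N /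
  -- c₀`, that is, `|v_i| ≤ m`; the chain property places all of these in a single subspace.
  have hcheap : ∀ x, varCost price v b x < ENNReal.ofReal (4 * (N + 1)) →
      x ∈ anchoredSubspace w b := fun x hx => by
    obtain ⟨i, hxi, hi⟩ := exists_of_varCost_lt hx
    refine anchoredSubspace_mono (hvw i ?_) b hxi
    have hi1 : 1 ≤ (v i).card := (hvne i).card_pos
    have hi2 : (price (v i).card : ℝ) < 4 * (N + 1) := by
      rw [← ENNReal.ofReal_coe_nnreal] at hi
      exact (ENNReal.ofReal_lt_ofReal_iff (by linarith)).1 hi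
    have hi3 : ((v i).card : ℝ) ^ s ≤ 8 / c₀ * N := by
      rw [div_mul_eq_mul_div, le_div_iff₀' hc₀]
      exact (h_price _ hi1).trans (by linarith)
    have hi4 : ((v i).card : ℝ) ≤ m := by
      refine le_trans ?_ hNm
      rw [← Real.mul_rpow (by positivity) hN0.le]
      exact (Real.le_rpow_inv_iff_of_pos (by positivity) (by positivity) hs).2 hi3
    exact_mod_cast hi4
  refine le_trans (ENNReal.ofReal_le_ofReal ?_) (le_error_sq_of_hasTailWeights hk_meas hk hk_int
    hk_anova hk_pos hγ hγ_empty hγ_sum Q hcC (by linarith) hcost hcheap hδ hp hm1 hw htail)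
  rw [mul_assoc]
  have hmin : 0 < min δ 1 := lt_min hδ one_pos
  gcongr
  have : N ^ (-((p - 1) / s)) = (N ^ s⁻¹) ^ (1 - p) := by
    rw [← Real.rpow_mul hN0.le]
    congr 1
    rw [div_eq_mul_inv]
    ring
  rw [this, ← Real.mul_rpow (by positivity) (by positivity), mul_assoc]
  exact Real.rpow_le_rpow_of_nonpos hm0 hmN (by linarith)

end LowerBounds

/-! ### From natural numbers to real budgets -/

theorem frequently_real_of_frequently_nat {P : ℕ → Prop} (h : ∃ᶠ m : ℕ in atTop, P m) {L θ : ℝ}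
    (hL : 0 < L) (hθ : 0 < θ) :
    ∃ᶠ N : ℝ in atTop, ∃ m : ℕ, P m ∧ L * N ^ θ ≤ m ∧ (m : ℝ) ≤ 2 * (L * N ^ θ) := by
  have ht : Tendsto (fun m : ℕ => ((m : ℝ) / L) ^ θ⁻¹) atTop atTop :=
    (tendsto_rpow_atTop (inv_pos.2 hθ)).comp
      (tendsto_natCast_atTop_atTop.atTop_div_const hL)
  -- For given `m`, the budget `N = (m / L)^(1/θ)` makes `L * N^θ` equal to `m`. The factor two is
  -- needed only for the rounding in the eventual version.
  refine ht.frequently (h.mono fun m hm => ⟨m, hm, ?_⟩)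
  have : L * (((m : ℝ) / L) ^ θ⁻¹) ^ θ = m := by
    rw [← Real.rpow_mul (by positivity), inv_mul_cancel₀ hθ.ne', Real.rpow_one,
      mul_div_cancel₀ _ hL.ne']
  rw [this]
  exact ⟨le_rfl, by linarith [Nat.cast_nonneg (α := ℝ) m]⟩

theorem eventually_real_of_eventually_nat {P : ℕ → Prop} (h : ∀ᶠ m : ℕ in atTop, P m) {L θ : ℝ}
    (hL : 0 < L) (hθ : 0 < θ) :
    ∀ᶠ N : ℝ in atTop, ∃ m : ℕ, P m ∧ L * N ^ θ ≤ m ∧ (m : ℝ) ≤ 2 * (L * N ^ θ) := by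
  have ht : Tendsto (fun N : ℝ => L * N ^ θ) atTop atTop :=
    (tendsto_rpow_atTop hθ).const_mul_atTop hL
  filter_upwards [(tendsto_nat_ceil_atTop.comp ht).eventually h, ht.eventually_ge_atTop 1]
    with N h1 h2
  refine ⟨_, h1, Nat.le_ceil _, ?_⟩
  have := Nat.ceil_lt_add_one (a := L * N ^ θ) (by linarith)
  simp only [Function.comp_apply]
  linarith

/-! ### Proof of the corollary -/

theorem mainTheorem4
    (D : Set ℝ) (ρ : Measure D) [IsProbabilityMeasure ρ]
    (k : D → D → ℝ)
    (hk_meas : Measurable (Function.uncurry k))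
    (hk_psd : (Matrix.of k).PosSemidef)
    (hk_int : Integrable (fun x => k x x) ρ)
    (hk_anova : ∀ y, ∫ x, k x y ∂ρ = 0)
    (hk_pos : ∀ a, 0 < k a a)
    (γ : Finset ℕ+ → ℝ)
    (hγ_nonneg : ∀ u, 0 ≤ γ u)
    (hγ_empty : γ ∅ = 1)
    (hγ_sum : Summable fun u : Finset ℕ+ => γ u * (∫ x, k x x ∂ρ) ^ u.card)
    -- the set of admissible anchors
    (𝒜 : Set (ℕ+ → D)) (h𝒜 : 𝒜 ⊆ infDomain k γ)
    (hγ : (IsFiniteIntersectionWeights γ ∧ MonotonicityCondition γ ∧ 0 < γ {1} ∧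
        ∀ b ∈ 𝒜, ∃ t : D, b = fun _ => t) ∨ IsProductWeights γ)
    (price : ℕ → ℝ≥0) (h_mono : Monotone price)
    (s : ℝ) (hs : 0 < s)
    (h_price : ∃ c : ℝ, 0 < c ∧ ∀ ν : ℕ, 1 ≤ ν → c * (ν : ℝ) ^ s ≤ price ν)
    -- the constant anchor with respect to which the decay is computed
    (a : D) (ha : (fun _ => a) ∈ infDomain k γ)
    (p : ℝ) (hp : decay k γ (fun _ => a) < (p : EReal))
    (α : ℝ) (hα : 0 < α)
    (h_univ : ∃ c : ℝ, 0 < c ∧ ∀ᶠ N : ℝ in atTop,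
      ENNReal.ofReal (c * N ^ (-α)) ≤ univariateMinError k ρ γ N ^ 2) :
    ((∃ c : ℝ, 0 < c ∧ ∃ᶠ N : ℝ in atTop,
        ENNReal.ofReal (c * N ^ (-(α * (p - 1) / (α * s + p - 1)))) ≤
          fixedMinError k ρ γ price 𝒜 N ^ 2) ∧
      (∃ c : ℝ, 0 < c ∧ ∃ᶠ N : ℝ in atTop,
        ENNReal.ofReal (c * N ^ (-(min α ((p - 1) / s)))) ≤
          varMinError k ρ γ price 𝒜 N ^ 2)) ∧
    (PolynomialLowerBound k γ (fun _ => a) p →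
      (∃ c : ℝ, 0 < c ∧ ∀ᶠ N : ℝ in atTop,
        ENNReal.ofReal (c * N ^ (-(α * (p - 1) / (α * s + p - 1)))) ≤
          fixedMinError k ρ γ price 𝒜 N ^ 2) ∧
      (∃ c : ℝ, 0 < c ∧ ∀ᶠ N : ℝ in atTop,
        ENNReal.ofReal (c * N ^ (-(min α ((p - 1) / s)))) ≤
          varMinError k ρ γ price 𝒜 N ^ 2)) := by
  obtain ⟨c₀, hc₀, h_price⟩ := h_price
  obtain ⟨c₁, hc₁, h_univ⟩ := exists_univariate_lower_bound hα h_univ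
  obtain ⟨κ, hκ, hκk⟩ := exists_kernel_lower_bound hk_meas hk_psd hk_int hk_anova hk_pos hγ_nonneg
    hγ_empty hc₁ (by simpa using h_univ 1 le_rfl) a
  have hp1 : 1 < p := one_lt_of_decay_lt hk_pos hγ_nonneg ha hp
  have hγ' : IsFiniteIntersectionWeights γ ∨ IsProductWeights γ := hγ.imp_left And.left
  have hsub : ∀ b ∈ 𝒜, ∀ v, anchoredSubspace v b ⊆ infDomain k γ := fun b hb v =>
    anchoredSubspace_subset_infDomain hk_pos hγ_nonneg hγ' (h𝒜 hb) v
  obtain ⟨htail, htail'⟩ := exists_hasTailWeights hk_pos hγ_nonneg hγ' hκ hκk ha hp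
  have hden : 0 < α * s + p - 1 := by nlinarith [mul_pos hα hs]
  have hB : 0 < max 1 (2 / c₀) := lt_max_of_lt_left one_pos
  have hL : 0 < (8 / c₀) ^ s⁻¹ := by positivity
  have hfix : ∀ δ > 0, ∃ c : ℝ, 0 < c ∧ ∀ N : ℝ, 1 ≤ N →
      (∃ m : ℕ, HasTailWeights k γ δ p m ∧ 1 * N ^ (α / (α * s + p - 1)) ≤ m ∧
        (m : ℝ) ≤ 2 * (1 * N ^ (α / (α * s + p - 1)))) →
      ENNReal.ofReal (c * N ^ (-(α * (p - 1) / (α * s + p - 1)))) ≤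
        fixedMinError k ρ γ price 𝒜 N ^ 2 := by
    intro δ hδ
    have hδ1 : 0 < min δ 1 := lt_min hδ one_pos
    refine ⟨min (3 / 8 * min δ 1 * 2 ^ (1 - p)) (c₁ * (max 1 (2 / c₀)) ^ (-α)),
      lt_min (by positivity) (by positivity), fun N hN ⟨m, hm, h1, h2⟩ => ?_⟩
    rw [one_mul] at h1 h2
    exact le_fixedMinError_sq hk_meas hk_psd hk_int hk_anova hk_pos hγ_nonneg hγ_empty hγ_sum hsub
      hs hc₀ h_price hα h_univ hδ hp1 hm hN h1 h2
  have hvar : ∀ δ > 0, ∃ c : ℝ, 0 < c ∧ ∀ N : ℝ, 1 ≤ N →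
      (∃ m : ℕ, HasTailWeights k γ δ p m ∧ (8 / c₀) ^ s⁻¹ * N ^ s⁻¹ ≤ m ∧
        (m : ℝ) ≤ 2 * ((8 / c₀) ^ s⁻¹ * N ^ s⁻¹)) →
      ENNReal.ofReal (c * N ^ (-(min α ((p - 1) / s)))) ≤ varMinError k ρ γ price 𝒜 N ^ 2 := by
    intro δ hδ
    have hδ1 : 0 < min δ 1 := lt_min hδ one_pos
    -- Only the bound with the smaller exponent is needed.
    rcases min_choice α ((p - 1) / s) with hmin | hmin <;> rw [hmin]
    · exact ⟨c₁ * (max 1 (2 / c₀)) ^ (-α), by positivity, fun N hN _ =>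
        le_varMinError_sq_of_univariate hk_psd hk_int hγ_nonneg hγ_sum hsub hs hc₀ h_price h_univ
          hN⟩
    · exact ⟨3 / 8 * min δ 1 * (2 * (8 / c₀) ^ s⁻¹) ^ (1 - p), by positivity,
        fun N hN ⟨m, hm, h1, h2⟩ => le_varMinError_sq_of_hasTailWeights hk_meas hk_psd hk_int
          hk_anova hk_pos hγ_nonneg hγ_empty hγ_sum hs hc₀ h_price hδ hp1 hm hN h1 h2⟩
  refine ⟨?_, fun hlow => ?_⟩
  · obtain ⟨δ, hδ, hfreq⟩ := htail
    obtain ⟨c, hc, hcN⟩ := hfix δ hδ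
    obtain ⟨c', hc', hcN'⟩ := hvar δ hδ
    exact ⟨⟨c, hc, ((frequently_real_of_frequently_nat hfreq one_pos
        (div_pos hα hden)).and_eventually (eventually_ge_atTop 1)).mono fun N h => hcN N h.2 h.1⟩,
      ⟨c', hc', ((frequently_real_of_frequently_nat hfreq hL
        (inv_pos.2 hs)).and_eventually (eventually_ge_atTop 1)).mono fun N h => hcN' N h.2 h.1⟩⟩
  · obtain ⟨δ, hδ, hev⟩ := htail' hlow
    obtain ⟨c, hc, hcN⟩ := hfix δ hδ
    obtain ⟨c', hc', hcN'⟩ := hvar δ hδ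
    exact ⟨⟨c, hc, ((eventually_real_of_eventually_nat hev one_pos
        (div_pos hα hden)).and (eventually_ge_atTop 1)).mono fun N h => hcN N h.2 h.1⟩,
      ⟨c', hc', ((eventually_real_of_eventually_nat hev hL
        (inv_pos.2 hs)).and (eventually_ge_atTop 1)).mono fun N h => hcN' N h.2 h.1⟩⟩
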